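/- Let $X$ be a compact connected complex manifold with a Kähler metric (for instance a smooth projective variety), with volume form ${\rm dvol}$, and let $\Omega^1(F)=\Omega^1_X\otimes_{\mathcal O_X}F$ for an $\mathcal O_X$-module $F$. *Connections.* The first jet sheaf $\mathcal J^1(F)$ is the abelian sheaf $F\oplus\Omega^1(F)$ with the $\mathcal O_X$-module structure $f\cdot(\sigma\oplus\beta)=f\sigma\oplus(f\beta+df\otimes\sigma)$; let $\iota:\Omega^1(F)\to\mathcal J^1(F)$ and $\pi:\mathcal J^1(F)\to F$ be the inclusion and the projection. A (holomorphic) connection on $F$ is an $\mathcal O_X$-linear $\varphi:F\to\mathcal J^1(F)$ with $\pi\circ\varphi={\rm id}$; then $\varphi(\sigma)=\sigma\oplus\nabla\sigma$, and the connection is also denoted $\nabla$. Its curvature is $K_\nabla=\nabla^{(1)}\circ\nabla:F\to\Omega^2(F)$. For $E\in{\rm Hom}(F,\Omega^1(F))$ and $\varepsilon\in\mathbb C$, the connection $\nabla+\varepsilon E$ is the one given by $\varphi+\varepsilon\,\iota\circ E$. *Hermitian sheaves.* Let $F$ be a coherent sheaf, $F(x)=F_x/\mathfrak m_xF_x$ its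 fiber at $x$, and $S\subset X$ the set of points at which $F$ is not locally free. A Hermitian metric on $F$ is a family of Hermitian inner products on the fibers $F(x)$, $x\in X$, such that for any two sections $Z_1,Z_2$ of $F$ on an open set $U$ the function $x\mapsto\langle Z_1(x),Z_2(x)\rangle$ is locally bounded on $U$ and $C^\infty$ on $U\setminus S$. For a connection $\nabla$ on a reflexive coherent sheaf $F$ with a Hermitian metric put $$\|K_\nabla\|^2=\int_{X\setminus S}|K_\nabla(x)|^2\,{\rm dvol},$$ where $|\cdot|$ is the norm on $\Omega^2(x)\otimes{\rm End}(F(x))$ induced by the two metrics. $\nabla$ is a *Yang–Mills field* if it is a stationary point of this functional: for every $E\in{\rm Hom}(F,\Omega^1(F))$ the integrals $\|K_{\nabla+\varepsilon E}\|^2$, $\varepsilon\in\mathbb C$, converge and the function $\varepsilon\mapsto\|K_{\nabla+\varepsilon E}\|^2$ on $\mathbb C=\mathbb R^2$ has derivative $0$ at $\varepsilon=0$. *Branes.* A brane is a bounded complex $F^\bullet$ of coherent sheaves on $X$; let $\mathcal H^i$ be its cohomology sheaves. A gauge field on it is a morphism $\psi:F^\bullet\to\mathcal J^1(F^\bullet)$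 in the derived category of $\mathcal O_X$-modules with $\pi\circ\psi={\rm id}$. As $\mathcal H^i(\mathcal J^1(F^\bullet))=\mathcal J^1(\mathcal H^i)$, it induces on each $\mathcal H^i$ the connection $\vartheta^i$ given by $\mathcal H^i(\psi):\mathcal H^i\to\mathcal J^1(\mathcal H^i)$. Assume that each $\mathcal H^i$ is reflexive and is equipped with a Hermitian metric. The Yang–Mills functional is $$\mathcal{YM}(\psi)=\sum_i(-1)^i\|K_{\vartheta^i}\|^2,$$ and $\psi$ is a *Yang–Mills field on the brane* if it is a critical point: for every morphism $\xi:F^\bullet\to\Omega^1(F^\bullet)$ in the derived category, the integrals that define $\mathcal{YM}(\psi+\varepsilon\,\iota\circ\xi)$, $\varepsilon\in\mathbb C$, converge and the function $\varepsilon\mapsto\mathcal{YM}(\psi+\varepsilon\,\iota\circ\xi)$ on $\mathbb C=\mathbb R^2$ has derivative $0$ at $\varepsilon=0$. **Proposition.** Let $\psi$ be a gauge field on such a brane $F^\bullet$. If the induced connection $\vartheta^i$ is a Yang–Mills field on $\mathcal H^i$ for every $i$, then $\psi$ is a Yang–Mills field on the brane. -/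

import Mathlib

open scoped Manifold ContDiff

noncomputable section

namespace BraneYM

open CategoryTheory Opposite TopologicalSpace

section Generic

variable {X : TopCat.{0}} (R : Sheaf (Opens.grothendieckTopology X) CommRingCat.{0})

/-- The sheaf of commutative rings `R`, viewed as a sheaf of rings. -/
abbrev ringSheaf : Sheaf (Opens.grothendieckTopology X) RingCat.{0} :=
  ⟨R.obj ⋙ forget₂ CommRingCat RingCat,
    ((sheafCompose (Opens.grothendieckTopology X) (forget₂ CommRingCat RingCat)).obj R).property⟩

/-- Presheaves of `R`-modules. -/
abbrev PMod := PresheafOfModules.{0} (R.obj ⋙ forget₂ CommRingCat RingCat)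

/-- The (abelian) category of sheaves of `R`-modules. -/
abbrev SMod := SheafOfModules.{0} (ringSheaf R)

variable {R}

/-- Restriction of functions. -/
def rres {U V : Opens X} (h : V ≤ U) : R.obj.obj (op U) →+* R.obj.obj (op V) :=
  (R.obj.map (homOfLE h).op).hom

/-- Restriction of sections of a presheaf of modules. -/
def res (M : PMod R) {U V : Opens X} (h : V ≤ U) : M.obj (op U) →+ M.obj (op V) :=
  (M.presheaf.map (homOfLE h).op).hom

theorem rres_rres {U V W : Opens X} (h : V ≤ U) (h' : W ≤ V) (f : R.obj.obj (op U)) :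
    rres h' (rres h f) = rres (h'.trans h) f := by
  simp only [rres]
  rw [← CommRingCat.comp_apply, ← Functor.map_comp]; rfl

theorem res_res (M : PMod R) {U V W : Opens X} (h : V ≤ U) (h' : W ≤ V) (s : M.obj (op U)) :
    res M h' (res M h s) = res M (h'.trans h) s := by
  simp only [res]
  exact (ConcreteCategory.congr_hom (M.presheaf.map_comp (homOfLE h).op (homOfLE h').op) s).symm

theorem rres_self {U : Opens X} (f : R.obj.obj (op U)) : rres le_rfl f = f :=
  ConcreteCategory.congr_hom (R.obj.map_id (op U)) f

theorem res_self (M : PMod R) {U : Opens X} (s : M.obj (op U)) : res M le_rfl s = s :=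
  ConcreteCategory.congr_hom (M.presheaf.map_id (op U)) s

theorem res_smul (M : PMod R) {U V : Opens X} (h : V ≤ U) (f : R.obj.obj (op U))
    (s : M.obj (op U)) : res M h (f • s) = rres h f • res M h s :=
  M.map_smul (homOfLE h).op f s

theorem res_app {M N : PMod R} (φ : M ⟶ N) {U V : Opens X} (h : V ≤ U) (s : M.obj (op U)) :
    φ.app (op V) (res M h s) = res N h (φ.app (op U) s) :=
  PresheafOfModules.naturality_apply φ (homOfLE h).op s

/-- The underlying sheaf of abelian groups has unique gluing. -/
theorem exists_glue (F : SMod R) {ι : Type} (U : ι → Opens X) (V : Opens X) (hU : ∀ i, U i ≤ V)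
    (hV : V ≤ iSup U) (s : ∀ i, F.val.obj (op (U i)))
    (hs : ∀ i j, res F.val (inf_le_left : U i ⊓ U j ≤ U i) (s i) =
      res F.val (inf_le_right : U i ⊓ U j ≤ U j) (s j)) :
    ∃! t : F.val.obj (op V), ∀ i, res F.val (hU i) t = s i := by
  let G : TopCat.Sheaf Ab X := ⟨F.val.presheaf, F.isSheaf⟩
  let s' : ∀ i, ToType (G.obj.obj (op (U i))) := s
  have h : TopCat.Presheaf.IsCompatible G.obj U s' := hs
  exact G.existsUnique_gluing' U V (fun i => homOfLE (hU i)) hV s' h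

theorem eq_of_res (F : SMod R) {ι : Type} (U : ι → Opens X) (V : Opens X) (hU : ∀ i, U i ≤ V)
    (hV : V ≤ iSup U) (s t : F.val.obj (op V))
    (hs : ∀ i, res F.val (hU i) s = res F.val (hU i) t) : s = t :=
  TopCat.Sheaf.eq_of_locally_eq' ⟨F.val.presheaf, F.isSheaf⟩ U V (fun i => homOfLE (hU i)) hV s t hs

/-- A section over `U` of the sheaf `ℋom_R(A, B)`. -/
@[ext]
structure HomSec (A B : PMod R) (U : Opens X) where
  app : ∀ V : Opens X, V ≤ U → (A.obj (op V) →ₗ[R.obj.obj (op V)] B.obj (op V))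
  natural : ∀ (V W : Opens X) (hV : V ≤ U) (hW : W ≤ V) (a : A.obj (op V)),
    res B hW (app V hV a) = app W (hW.trans hV) (res A hW a)

namespace HomSec
variable {A B : PMod R} {U : Opens X}

instance : Zero (HomSec A B U) := ⟨⟨fun _ _ => 0, by intros; simp⟩⟩
instance : Add (HomSec A B U) :=
  ⟨fun φ ψ => ⟨fun V h => φ.app V h + ψ.app V h, by intros; simp [φ.natural, ψ.natural]⟩⟩
instance : Neg (HomSec A B U) :=
  ⟨fun φ => ⟨fun V h => - φ.app V h, by intros; simp [φ.natural]⟩⟩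
instance : SMul (R.obj.obj (op U)) (HomSec A B U) :=
  ⟨fun f φ => ⟨fun V h => rres h f • φ.app V h, by
    intros; simp [φ.natural, res_smul, rres_rres]⟩⟩

@[simp] theorem zero_app (V : Opens X) (h : V ≤ U) : (0 : HomSec A B U).app V h = 0 := rfl
@[simp] theorem add_app (φ ψ : HomSec A B U) (V : Opens X) (h : V ≤ U) :
    (φ + ψ).app V h = φ.app V h + ψ.app V h := rfl
@[simp] theorem neg_app (φ : HomSec A B U) (V : Opens X) (h : V ≤ U) :
    (-φ).app V h = - φ.app V h := rfl
@[simp] theorem smul_app (f : R.obj.obj (op U)) (φ : HomSec A B U) (V : Opens X) (h : V ≤ U) :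
    (f • φ).app V h = rres h f • φ.app V h := rfl

instance : AddCommGroup (HomSec A B U) where
  add_assoc _ _ _ := by ext; simp [add_assoc]
  zero_add _ := by ext; simp
  add_zero _ := by ext; simp
  add_comm _ _ := by ext; simp [add_comm]
  neg_add_cancel _ := by ext; simp
  nsmul := nsmulRec
  zsmul := zsmulRec

instance : Module (R.obj.obj (op U)) (HomSec A B U) where
  one_smul _ := by ext; simp
  mul_smul _ _ _ := by ext; simp [mul_smul]
  smul_zero _ := by ext; simp
  smul_add _ _ _ := by ext; simp
  add_smul _ _ _ := by ext; simp [add_smul]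
  zero_smul _ := by ext; simp

theorem add_apply (φ ψ : HomSec A B U) (V : Opens X) (h : V ≤ U) (a : A.obj (op V)) :
    (φ + ψ).app V h a = φ.app V h a + ψ.app V h a := rfl
theorem zero_apply (V : Opens X) (h : V ≤ U) (a : A.obj (op V)) :
    (0 : HomSec A B U).app V h a = 0 := rfl
theorem smul_apply (f : R.obj.obj (op U)) (φ : HomSec A B U) (V : Opens X) (h : V ≤ U)
    (a : A.obj (op V)) : (f • φ).app V h a = rres h f • φ.app V h a := rfl

/-- Restriction of local homomorphisms to a smaller open set. -/
def restrict {V : Opens X} (h : V ≤ U) (φ : HomSec A B U) : HomSec A B V :=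
  ⟨fun W hW => φ.app W (hW.trans h), fun _ _ hV hW a => φ.natural _ _ (hV.trans h) hW a⟩

/-- Composition with a morphism of presheaves of modules. -/
def postcomp {B' : PMod R} (g : B ⟶ B') (φ : HomSec A B U) : HomSec A B' U :=
  ⟨fun W hW => (g.app (op W)).hom.comp (φ.app W hW), fun V W hV hW a => by
    have := res_app g hW (φ.app V hV a)
    rw [φ.natural] at this
    exact this.symm⟩

@[simp] theorem restrict_app {V : Opens X} (h : V ≤ U) (φ : HomSec A B U) (W : Opens X)
    (hW : W ≤ V) : (φ.restrict h).app W hW = φ.app W (hW.trans h) := rfl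

@[simp] theorem postcomp_app {B' : PMod R} (g : B ⟶ B') (φ : HomSec A B U) (W : Opens X)
    (hW : W ≤ U) (a : A.obj (op W)) : (φ.postcomp g).app W hW a = g.app (op W) (φ.app W hW a) := rfl

end HomSec

/-- The gluing property of a presheaf of modules, in terms of restriction maps. -/
theorem isSheaf_of_glue (M : PMod R)
    (h : ∀ (ι : Type) (U : ι → Opens X) (s : ∀ i, M.obj (op (U i))),
      (∀ i j, res M (inf_le_left : U i ⊓ U j ≤ U i) (s i) =
        res M (inf_le_right : U i ⊓ U j ≤ U j) (s j)) →
      ∃! t : M.obj (op (iSup U)), ∀ i, res M (le_iSup U i) t = s i) :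
    CategoryTheory.Presheaf.IsSheaf (Opens.grothendieckTopology X) M.presheaf := by
  have : TopCat.Presheaf.IsSheaf M.presheaf := by
    rw [TopCat.Presheaf.isSheaf_iff_isSheafUniqueGluing]
    intro ι U s hs
    exact h ι U s hs
  exact this

/-- Constructor for presheaves of modules from restriction maps. -/
def mkPMod (M : Opens X → Type) [∀ U, AddCommGroup (M U)]
    [inst : ∀ U, Module (R.obj.obj (op U)) (M U)] (r : ∀ {U V : Opens X}, V ≤ U → M U →+ M V)
    (r_self : ∀ (U : Opens X) (s : M U), r le_rfl s = s)
    (r_r : ∀ {U V W : Opens X} (h : V ≤ U) (h' : W ≤ V) (s : M U), r h' (r h s) = r (h'.trans h) s)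
    (r_smul : ∀ {U V : Opens X} (h : V ≤ U) (f : R.obj.obj (op U)) (s : M U),
      r h (f • s) = rres h f • r h s) : PMod R :=
  letI P : TopCat.Presheaf Ab X :=
    { obj := fun U => AddCommGrpCat.of (M U.unop)
      map := fun {U V} f => AddCommGrpCat.ofHom (r (leOfHom f.unop))
      map_id := fun U => by ext s; exact r_self U.unop s
      map_comp := fun {U V W} f g => by
        ext s; exact (r_r (leOfHom f.unop) (leOfHom g.unop) s).symm }
  letI : ∀ U, Module ((R.obj ⋙ forget₂ CommRingCat RingCat).obj U) (P.obj U) :=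
    fun U => inst U.unop
  PresheafOfModules.ofPresheaf P (fun {U V} f c m => r_smul (leOfHom f.unop) c m)

/-- The presheaf `U ↦ Hom_{R|_U}(A|_U, B|_U)`. -/
def homPre (A B : PMod R) : PMod R :=
  mkPMod (HomSec A B) (fun h => AddMonoidHom.mk' (HomSec.restrict h) (fun _ _ => rfl))
    (fun _ _ => rfl) (fun _ _ _ => rfl) (fun h f φ => by
      ext W hW a
      exact congrArg (· • φ.app W _ a) (rres_rres h hW f).symm)

theorem HomSec.glue (A : PMod R) (F : SMod R) (ι : Type) (U : ι → Opens X)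
    (φ : ∀ i, HomSec A F.val (U i))
    (hφ : ∀ i j, (φ i).restrict (inf_le_left : U i ⊓ U j ≤ U i) =
      (φ j).restrict (inf_le_right : U i ⊓ U j ≤ U j)) :
    ∃! t : HomSec A F.val (iSup U), ∀ i, t.restrict (le_iSup U i) = φ i := by
  have hc : ∀ (V : Opens X), V ≤ iSup U → V ≤ ⨆ i, V ⊓ U i := fun V hV => by
    rw [← inf_iSup_eq]; exact le_inf le_rfl hV
  have hcomp : ∀ (i j) (W : Opens X) (h : W ≤ U i) (h' : W ≤ U j) (a : A.obj (op W)),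
      (φ i).app W h a = (φ j).app W h' a := fun i j W h h' a => by
    have := congrArg (fun t => t.app W (le_inf h h') a) (hφ i j)
    exact this
  have key : ∀ (V : Opens X) (hV : V ≤ iSup U) (a : A.obj (op V)),
      ∃! t : F.val.obj (op V), ∀ i, res F.val (inf_le_left : V ⊓ U i ≤ V) t =
        (φ i).app (V ⊓ U i) inf_le_right (res A inf_le_left a) := fun V hV a =>
    exists_glue F (fun i => V ⊓ U i) V (fun i => inf_le_left) (hc V hV) _ (fun i j => by
      rw [(φ i).natural, (φ j).natural, res_res, res_res]
      exact hcomp i j _ _ _ _)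
  choose g hg hu using key
  have huniq : ∀ (V : Opens X) (hV : V ≤ iSup U) (a : A.obj (op V)) (t : F.val.obj (op V)),
      (∀ i, res F.val (inf_le_left : V ⊓ U i ≤ V) t =
        (φ i).app (V ⊓ U i) inf_le_right (res A inf_le_left a)) → t = g V hV a := hu
  refine ⟨⟨fun V hV =>
    { toFun := g V hV
      map_add' := fun a b => ?_
      map_smul' := fun f a => ?_ }, ?_⟩, ?_, ?_⟩
  · exact (huniq V hV (a + b) _ (fun i => by
      rw [map_add, hg V hV a i, hg V hV b i, map_add, map_add])).symm
  · exact (huniq V hV (f • a) _ (fun i => by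
      rw [RingHom.id_apply, res_smul, hg V hV a i, res_smul, map_smul])).symm
  · intro V W hV hW a
    refine huniq W _ _ _ (fun i => ?_)
    have h1 : W ⊓ U i ≤ V ⊓ U i := inf_le_inf_right _ hW
    have h2 := congrArg (res F.val h1) (hg V hV a i)
    rw [res_res, (φ i).natural, res_res] at h2
    simp only [LinearMap.coe_mk, AddHom.coe_mk]
    rw [res_res, res_res]
    exact h2
  · intro i
    ext V hV a
    refine (huniq V (hV.trans (le_iSup U i)) a _ (fun j => ?_)).symm
    rw [(φ i).natural]
    exact hcomp i j _ _ _ _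
  · intro t ht
    ext V hV a
    refine huniq V hV a _ (fun i => ?_)
    rw [t.natural, ← ht i]
    rfl

/-- The sheaf `ℋom_R(A, F)` of local homomorphisms into a sheaf of modules. -/
def homSheaf (A : PMod R) (F : SMod R) : SMod R :=
  ⟨homPre A F.val, isSheaf_of_glue _ (fun ι U s hs => HomSec.glue A F ι U s hs)⟩

/-- Constructor for morphisms of presheaves of modules. -/
def mkHom {M N : PMod R}
    (φ : ∀ U : Opens X, M.obj (op U) →ₗ[R.obj.obj (op U)] N.obj (op U))
    (hφ : ∀ (U V : Opens X) (h : V ≤ U) (s : M.obj (op U)), φ V (res M h s) = res N h (φ U s)) :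
    M ⟶ N where
  app U := ModuleCat.ofHom (φ U.unop)
  naturality {U V} f := by
    ext s
    exact hφ U.unop V.unop (leOfHom f.unop) s

/-- The functor `F ↦ ℋom_R(A, F)`. -/
def homFunctor (A : PMod R) : SMod R ⥤ SMod R where
  obj F := homSheaf A F
  map {F G} g := ⟨mkHom (M := homPre A F.val) (N := homPre A G.val)
    (fun U =>
      { toFun := fun φ => HomSec.postcomp g.val φ
        map_add' := fun φ ψ => by
          apply HomSec.ext; funext W hW; ext a
          exact map_add (g.val.app (op W)).hom _ _
        map_smul' := fun f φ => by
          apply HomSec.ext; funext W hW; ext a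
          exact map_smul (g.val.app (op W)).hom _ _ })
    (fun _ _ _ _ => rfl)⟩

instance (A : PMod R) : (homFunctor A).Additive where
  map_add := rfl

end Generic

section Manifold

variable {n : ℕ} {X : Type} [TopologicalSpace X] [ChartedSpace (Fin n → ℂ) X]

variable (X) in
/-- The space `X` as an object of the category of topological spaces. -/
def Sp : TopCat.{0} := TopCat.of X

variable (n X) in
/-- The sheaf `𝒪_X` of holomorphic functions on the complex manifold `X`. -/
def HolSheaf : Sheaf (Opens.grothendieckTopology (Sp X)) CommRingCat.{0} :=
  smoothSheafCommRing 𝓘(ℂ, Fin n → ℂ) 𝓘(ℂ) X ℂ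

variable (n X) in
/-- The category of `𝒪_X`-modules. -/
abbrev OMod := SMod (HolSheaf n X)

variable (n) in
/-- The ring `𝒪_X(U)` of holomorphic functions on `U`. -/
abbrev Hol (U : Opens (Sp X)) : Type := (HolSheaf n X).obj.obj (op U)

instance (U : Opens (Sp X)) : Algebra ℂ (Hol n U) :=
  letI U' : Opens X := U
  (ContMDiffMap.algebra : Algebra ℂ C^∞⟮𝓘(ℂ, Fin n → ℂ), U'; 𝓘(ℂ), ℂ⟯)

theorem rres_algebraMap {U V : Opens (Sp X)} (h : V ≤ U) (c : ℂ) :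
    rres (R := HolSheaf n X) h (algebraMap ℂ (Hol n U) c) = algebraMap ℂ (Hol n V) c := rfl

/-- A holomorphic vector field on `U`, viewed as a `ℂ`-linear derivation of the sheaf `𝒪_X|_U`. -/
@[ext]
structure Vec (n : ℕ) {X : Type} [TopologicalSpace X] [ChartedSpace (Fin n → ℂ) X]
    (U : Opens (Sp X)) where
  app : ∀ V : Opens (Sp X), V ≤ U → Derivation ℂ (Hol n V) (Hol n V)
  natural : ∀ (V W : Opens (Sp X)) (hV : V ≤ U) (hW : W ≤ V) (f : Hol n V),
    rres (R := HolSheaf n X) hW (app V hV f) = app W (hW.trans hV) (rres (R := HolSheaf n X) hW f)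

namespace Vec
variable {U : Opens (Sp X)}

instance : Zero (Vec n U) := ⟨⟨fun _ _ => 0, by intros; simp⟩⟩
instance : Add (Vec n U) :=
  ⟨fun v w => ⟨fun V h => v.app V h + w.app V h, by intros; simp [v.natural, w.natural]⟩⟩
instance : Neg (Vec n U) := ⟨fun v => ⟨fun V h => - v.app V h, by intros; simp [v.natural]⟩⟩
instance : SMul (Hol n U) (Vec n U) :=
  ⟨fun f v => ⟨fun V h => rres (R := HolSheaf n X) h f • v.app V h, by
    intros; simp [v.natural, rres_rres (R := HolSheaf n X)]⟩⟩

@[simp] theorem zero_app (V : Opens (Sp X)) (h : V ≤ U) : (0 : Vec n U).app V h = 0 := rfl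
@[simp] theorem add_app (v w : Vec n U) (V : Opens (Sp X)) (h : V ≤ U) :
    (v + w).app V h = v.app V h + w.app V h := rfl
@[simp] theorem neg_app (v : Vec n U) (V : Opens (Sp X)) (h : V ≤ U) :
    (-v).app V h = - v.app V h := rfl
@[simp] theorem smul_app (f : Hol n U) (v : Vec n U) (V : Opens (Sp X)) (h : V ≤ U) :
    (f • v).app V h = rres (R := HolSheaf n X) h f • v.app V h := rfl

theorem ext_apply {v w : Vec n U} (h : ∀ V hV f, v.app V hV f = w.app V hV f) : v = w := by
  apply Vec.ext; funext V hV; exact Derivation.ext (h V hV)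

instance : AddCommGroup (Vec n U) where
  add_assoc _ _ _ := ext_apply fun _ _ _ => by simp [add_assoc]
  zero_add _ := ext_apply fun _ _ _ => by simp
  add_zero _ := ext_apply fun _ _ _ => by simp
  add_comm _ _ := ext_apply fun _ _ _ => by simp [add_comm]
  neg_add_cancel _ := ext_apply fun _ _ _ => by simp
  nsmul := nsmulRec
  zsmul := zsmulRec

instance : Module (Hol n U) (Vec n U) where
  one_smul _ := ext_apply fun _ _ _ => by simp
  mul_smul _ _ _ := ext_apply fun _ _ _ => by simp [mul_assoc]
  smul_zero _ := ext_apply fun _ _ _ => by simp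
  smul_add _ _ _ := ext_apply fun _ _ _ => by simp
  add_smul _ _ _ := ext_apply fun _ _ _ => by simp [add_mul]
  zero_smul _ := ext_apply fun _ _ _ => by simp

/-- Restriction of vector fields. -/
def restrict {V : Opens (Sp X)} (h : V ≤ U) (v : Vec n U) : Vec n V :=
  ⟨fun W hW => v.app W (hW.trans h), fun _ _ hV hW f => v.natural _ _ (hV.trans h) hW f⟩

/-- The Lie bracket of vector fields, i.e. the commutator of derivations. -/
instance : Bracket (Vec n U) (Vec n U) :=
  ⟨fun v w => ⟨fun V h => ⁅v.app V h, w.app V h⁆, by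
    intros; simp [Derivation.commutator_apply, v.natural, w.natural]⟩⟩

@[simp] theorem bracket_app (v w : Vec n U) (V : Opens (Sp X)) (h : V ≤ U) :
    ⁅v, w⁆.app V h = ⁅v.app V h, w.app V h⁆ := rfl

end Vec

variable (n X) in
/-- The tangent sheaf `Θ_X`: holomorphic vector fields, i.e. derivations of `𝒪_X`. -/
def tangentSheaf : PMod (HolSheaf n X) :=
  mkPMod (Vec n) (fun h => AddMonoidHom.mk' (Vec.restrict h) (fun _ _ => rfl))
    (fun _ _ => rfl) (fun _ _ _ => rfl) (fun h f v => Vec.ext_apply fun W hW g => by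
      exact congrArg (· * v.app W _ g) (rres_rres (R := HolSheaf n X) h hW f).symm)

variable (n X) in
/-- The functor `F ↦ Ω¹(F) = Ω¹_X ⊗ F` of `F`-valued holomorphic `1`-forms. As `Ω¹_X` is the dual
of the locally free sheaf `Θ_X` of finite rank, `Ω¹_X ⊗ F` is `ℋom(Θ_X, F)`, where `ω ⊗ s` is the
form `v ↦ ω(v) s`. -/
def Om1 : OMod n X ⥤ OMod n X := homFunctor (tangentSheaf n X)

/-- The `F`-valued `1`-form `df ⊗ s : v ↦ v(f) s`. -/
def dTensor (F : PMod (HolSheaf n X)) {U : Opens (Sp X)} (f : Hol n U) (s : F.obj (op U)) :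
    HomSec (tangentSheaf n X) F U where
  app V h :=
    { toFun := fun v : Vec n V => (v.app V le_rfl (rres (R := HolSheaf n X) h f)) • res F h s
      map_add' := fun v w => add_smul (v.app V le_rfl (rres (R := HolSheaf n X) h f))
        (w.app V le_rfl (rres (R := HolSheaf n X) h f)) (res F h s)
      map_smul' := fun g v => by
        change (rres (R := HolSheaf n X) le_rfl g * _) • _ = g • _ • _
        rw [rres_self, mul_smul]; rfl }
  natural V W hV hW v := by
    change res F hW ((Vec.app v V le_rfl (rres (R := HolSheaf n X) hV f)) • res F hV s) =
      Vec.app v W hW (rres (R := HolSheaf n X) (hW.trans hV) f) • res F (hW.trans hV) s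
    rw [res_smul, res_res]
    congr 1
    exact (Vec.natural v V W le_rfl hW _).trans
      (congrArg _ (rres_rres (R := HolSheaf n X) hV hW f))

theorem dTensor_apply (F : PMod (HolSheaf n X)) {U : Opens (Sp X)} (f : Hol n U)
    (s : F.obj (op U)) (V : Opens (Sp X)) (h : V ≤ U) (v : Vec n V) :
    (dTensor F f s).app V h v = (v.app V le_rfl (rres (R := HolSheaf n X) h f)) • res F h s := rfl

theorem HomSec.ext_apply {F : PMod (HolSheaf n X)} {U : Opens (Sp X)}
    {φ ψ : HomSec (tangentSheaf n X) F U}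
    (h : ∀ (V : Opens (Sp X)) (hV : V ≤ U) (v : Vec n V), φ.app V hV v = ψ.app V hV v) : φ = ψ := by
  apply HomSec.ext; funext V hV; exact LinearMap.ext (h V hV)

theorem dTensor_add_right (F : PMod (HolSheaf n X)) {U : Opens (Sp X)} (f : Hol n U)
    (s t : F.obj (op U)) : dTensor F f (s + t) = dTensor F f s + dTensor F f t :=
  HomSec.ext_apply fun V hV v => by
    have h1 := map_add (res F hV) s t
    have h2 := smul_add (v.app V le_rfl (rres (R := HolSheaf n X) hV f)) (res F hV s) (res F hV t)
    exact (congrArg _ h1).trans h2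

theorem dTensor_zero_right (F : PMod (HolSheaf n X)) {U : Opens (Sp X)} (f : Hol n U) :
    dTensor F f (0 : F.obj (op U)) = 0 := by
  have := dTensor_add_right F f 0 0
  rwa [add_zero, left_eq_add] at this

theorem dTensor_add_left (F : PMod (HolSheaf n X)) {U : Opens (Sp X)} (f g : Hol n U)
    (s : F.obj (op U)) : dTensor F (f + g) s = dTensor F f s + dTensor F g s :=
  HomSec.ext_apply fun V hV v => by
    have h1 : v.app V le_rfl (rres (R := HolSheaf n X) hV (f + g)) =
        v.app V le_rfl (rres (R := HolSheaf n X) hV f) +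
          v.app V le_rfl (rres (R := HolSheaf n X) hV g) := by rw [map_add, map_add]
    exact (congrArg (fun r : Hol n V => r • res F hV s) h1).trans (add_smul _ _ _)

theorem dTensor_mul (F : PMod (HolSheaf n X)) {U : Opens (Sp X)} (f g : Hol n U)
    (s : F.obj (op U)) : dTensor F (f * g) s = f • dTensor F g s + dTensor F f (g • s) :=
  HomSec.ext_apply fun V hV v => by
    have h1 : v.app V le_rfl (rres (R := HolSheaf n X) hV (f * g)) =
        rres (R := HolSheaf n X) hV f * v.app V le_rfl (rres (R := HolSheaf n X) hV g) +
          v.app V le_rfl (rres (R := HolSheaf n X) hV f) * rres (R := HolSheaf n X) hV g := by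
      rw [map_mul, Derivation.leibniz, smul_eq_mul, smul_eq_mul,
        mul_comm (rres (R := HolSheaf n X) hV g)]
    have h2 := res_smul F hV g s
    refine (congrArg (fun r : Hol n V => r • res F hV s) h1).trans ((add_smul _ _ _).trans ?_)
    refine congrArg₂ (· + ·) (mul_smul _ _ _) ((mul_smul _ _ _).trans ?_)
    exact (congrArg (fun t => v.app V le_rfl (rres (R := HolSheaf n X) hV f) • t) h2).symm

theorem dTensor_algebraMap (F : PMod (HolSheaf n X)) {U : Opens (Sp X)} (c : ℂ)
    (s : F.obj (op U)) : dTensor F (algebraMap ℂ (Hol n U) c) s = 0 :=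
  HomSec.ext_apply fun V hV v => by
    have h1 : v.app V le_rfl (rres (R := HolSheaf n X) hV (algebraMap ℂ (Hol n U) c)) = 0 := by
      rw [rres_algebraMap, Derivation.map_algebraMap]
    exact (congrArg (fun r : Hol n V => r • res F hV s) h1).trans (zero_smul _ _)

theorem dTensor_restrict (F : PMod (HolSheaf n X)) {U V : Opens (Sp X)} (h : V ≤ U) (f : Hol n U)
    (s : F.obj (op U)) : (dTensor F f s).restrict h =
      dTensor F (rres (R := HolSheaf n X) h f) (res F h s) :=
  HomSec.ext_apply fun W hW v => by
    have h1 := rres_rres (R := HolSheaf n X) h hW f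
    have h2 := res_res F h hW s
    exact (congrArg₂ (fun (r : Hol n W) t => v.app W le_rfl r • t) h1 h2).symm

theorem dTensor_postcomp {F G : PMod (HolSheaf n X)} (g : F ⟶ G) {U : Opens (Sp X)} (f : Hol n U)
    (s : F.obj (op U)) : (dTensor F f s).postcomp g = dTensor G f (g.app (op U) s) :=
  HomSec.ext_apply fun W hW v => by
    have h2 := res_app g hW s
    refine (map_smul (g.app (op W)).hom (v.app W le_rfl (rres (R := HolSheaf n X) hW f))
      (res F hW s)).trans ?_
    exact congrArg (fun t => v.app W le_rfl (rres (R := HolSheaf n X) hW f) • t) h2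

/-- Sections over `U` of the first jet sheaf `J¹(F)`: pairs of a section of `F` and
an `F`-valued `1`-form. -/
def JetSec (F : PMod (HolSheaf n X)) (U : Opens (Sp X)) : Type :=
  F.obj (op U) × HomSec (tangentSheaf n X) F U

instance (F : PMod (HolSheaf n X)) (U : Opens (Sp X)) : AddCommGroup (JetSec F U) :=
  (inferInstance : AddCommGroup (F.obj (op U) × HomSec (tangentSheaf n X) F U))

/-- The `𝒪_X`-module structure of `J¹(F)`: `f · (s, β) = (f s, f β + df ⊗ s)`. -/
instance (F : PMod (HolSheaf n X)) (U : Opens (Sp X)) : SMul (Hol n U) (JetSec F U) :=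
  ⟨fun f p => (f • p.1, f • p.2 + dTensor F f p.1)⟩

theorem JetSec.smul_def {F : PMod (HolSheaf n X)} {U : Opens (Sp X)} (f : Hol n U)
    (p : JetSec F U) : f • p = (f • p.1, f • p.2 + dTensor F f p.1) := rfl

instance (F : PMod (HolSheaf n X)) (U : Opens (Sp X)) : Module (Hol n U) (JetSec F U) where
  one_smul p := by
    have h : dTensor F (1 : Hol n U) p.1 = 0 := by
      rw [← (algebraMap ℂ (Hol n U)).map_one]; exact dTensor_algebraMap F 1 p.1
    refine Prod.ext (one_smul _ _) ?_
    change (1 : Hol n U) • p.2 + dTensor F (1 : Hol n U) p.1 = p.2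
    rw [h, one_smul, add_zero]
  mul_smul f g p := by
    refine Prod.ext (mul_smul _ _ _) ?_
    change (f * g) • p.2 + dTensor F (f * g) p.1 =
      f • (g • p.2 + dTensor F g p.1) + dTensor F f (g • p.1)
    rw [dTensor_mul, mul_smul, smul_add, add_assoc]
  smul_zero f := by
    refine Prod.ext (smul_zero _) ?_
    change f • (0 : HomSec (tangentSheaf n X) F U) + dTensor F f (0 : F.obj (op U)) = 0
    rw [dTensor_zero_right, smul_zero, add_zero]
  smul_add f p q := by
    refine Prod.ext (smul_add _ _ _) ?_
    change f • (p.2 + q.2) + dTensor F f (p.1 + q.1) =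
      (f • p.2 + dTensor F f p.1) + (f • q.2 + dTensor F f q.1)
    rw [dTensor_add_right, smul_add]; abel
  add_smul f g p := by
    refine Prod.ext (add_smul _ _ _) ?_
    change (f + g) • p.2 + dTensor F (f + g) p.1 =
      (f • p.2 + dTensor F f p.1) + (g • p.2 + dTensor F g p.1)
    rw [dTensor_add_left, add_smul]; abel
  zero_smul p := by
    have h : dTensor F (0 : Hol n U) p.1 = 0 := by
      rw [← (algebraMap ℂ (Hol n U)).map_zero]; exact dTensor_algebraMap F 0 p.1
    refine Prod.ext (zero_smul _ _) ?_
    change (0 : Hol n U) • p.2 + dTensor F (0 : Hol n U) p.1 = 0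
    rw [h, zero_smul, add_zero]

/-- The first jet presheaf of modules. -/
def jetPre (F : PMod (HolSheaf n X)) : PMod (HolSheaf n X) :=
  mkPMod (JetSec F)
    (fun h => AddMonoidHom.mk' (fun p => ((res F h p.1, p.2.restrict h) : JetSec F _))
      (fun p q => Prod.ext (map_add (res F h) p.1 q.1) rfl))
    (fun _ p => Prod.ext (res_self F p.1) rfl)
    (fun h h' p => Prod.ext (res_res F h h' p.1) rfl)
    (fun h f p => Prod.ext (res_smul F h f p.1) (by
      change (f • p.2 + dTensor F f p.1).restrict h =
        rres (R := HolSheaf n X) h f • p.2.restrict h +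
          dTensor F (rres (R := HolSheaf n X) h f) (res F h p.1)
      rw [← dTensor_restrict]
      refine HomSec.ext_apply fun W hW v => ?_
      have h3 := (rres_rres (R := HolSheaf n X) h hW f)
      exact congrArg (fun r : Hol n W => r • p.2.app W (hW.trans h) v +
        (dTensor F f p.1).app W (hW.trans h) v) h3.symm))

variable (n X) in
/-- The first jet functor `F ↦ J¹(F)`. -/
def Jet : OMod n X ⥤ OMod n X where
  obj F := ⟨jetPre F.val, isSheaf_of_glue _ (fun ι U s hs => by
    have h1 := fun i j => congrArg Prod.fst (hs i j)
    have h2 := fun i j => congrArg Prod.snd (hs i j)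
    obtain ⟨a, ha, ha'⟩ := exists_glue F U (iSup U) (le_iSup U) le_rfl (fun i => (s i).1) h1
    obtain ⟨b, hb, hb'⟩ := HomSec.glue (tangentSheaf n X) F ι U (fun i => (s i).2) h2
    exact ⟨(a, b), fun i => Prod.ext (ha i) (hb i), fun t ht =>
      Prod.ext (ha' t.1 fun i => congrArg Prod.fst (ht i))
        (hb' t.2 fun i => congrArg Prod.snd (ht i))⟩)⟩
  map {F G} g := ⟨mkHom (M := jetPre F.val) (N := jetPre G.val)
    (fun U =>
      { toFun := fun p : JetSec F.val U => ((g.val.app (op U) p.1, p.2.postcomp g.val) : JetSec G.val U)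
        map_add' := fun p q => Prod.ext (map_add (g.val.app (op U)).hom p.1 q.1)
          (HomSec.ext_apply fun W hW v => map_add (g.val.app (op W)).hom (p.2.app W hW v) (q.2.app W hW v))
        map_smul' := fun f p => Prod.ext (map_smul (g.val.app (op U)).hom f p.1) (by
          change (f • p.2 + dTensor F.val f p.1).postcomp g.val =
            f • p.2.postcomp g.val + dTensor G.val f (g.val.app (op U) p.1)
          rw [← dTensor_postcomp]
          refine HomSec.ext_apply fun W hW v => ?_
          exact (map_add (g.val.app (op W)).hom _ _).trans
            (congrArg (· + _) (map_smul (g.val.app (op W)).hom _ (p.2.app W hW v)))) })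
    (fun U V h p => Prod.ext (res_app g.val h p.1) rfl)⟩

instance : (Jet n X).Additive where
  map_add := rfl

variable (n X) in
/-- The projection `π : J¹(F) → F`. -/
def jetπ : Jet n X ⟶ 𝟭 (OMod n X) where
  app F := ⟨mkHom (M := jetPre F.val) (N := F.val)
    (fun U =>
      { toFun := fun p : JetSec F.val U => p.1
        map_add' := fun _ _ => rfl
        map_smul' := fun _ _ => rfl }) (fun _ _ _ _ => rfl)⟩

variable (n X) in
/-- The inclusion `ι : Ω¹(F) → J¹(F)`. -/
def jetι : Om1 n X ⟶ Jet n X where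
  app F := ⟨mkHom (M := homPre (tangentSheaf n X) F.val) (N := jetPre F.val)
    (fun U =>
      { toFun := fun β : HomSec (tangentSheaf n X) F.val U => ((0, β) : JetSec F.val U)
        map_add' := fun _ _ => Prod.ext (add_zero _).symm rfl
        map_smul' := fun (f : Hol n U) (β : HomSec (tangentSheaf n X) F.val U) => by
          refine Prod.ext (smul_zero _).symm ?_
          change f • β = f • β + dTensor F.val f (0 : F.val.obj (op U))
          rw [dTensor_zero_right, add_zero] }) (fun U V h _ => Prod.ext (map_zero (res F.val h)).symm rfl)⟩
  naturality F G g := by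
    apply SheafOfModules.hom_ext
    ext U β
    exact Prod.ext (map_zero (g.val.app U).hom).symm rfl

end Manifold

section Homological
open Limits

variable {n : ℕ} {X : Type} [TopologicalSpace X] [ChartedSpace (Fin n → ℂ) X]

theorem PMod.hom_ext {F G : PMod (HolSheaf n X)} {f g : F ⟶ G}
    (h : ∀ (U : Opens (Sp X)) (s : F.obj (op U)), f.app (op U) s = g.app (op U) s) : f = g := by
  ext U s
  exact h U.unop s

theorem OMod.hom_ext {F G : OMod n X} {f g : F ⟶ G}
    (h : ∀ (U : Opens (Sp X)) (s : F.val.obj (op U)), f.val.app (op U) s = g.val.app (op U) s) :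
    f = g :=
  SheafOfModules.hom_ext (PMod.hom_ext h)

/-- Multiplication of a morphism of presheaves of `𝒪_X`-modules by a complex number. -/
instance (F G : PMod (HolSheaf n X)) : SMul ℂ (F ⟶ G) :=
  ⟨fun c g => mkHom
    (fun U =>
      { toFun := fun s => (algebraMap ℂ (Hol n U) c) • g.app (op U) s
        map_add' := fun s t => (congrArg (fun t => (algebraMap ℂ (Hol n U) c) • t)
          (map_add (g.app (op U)).hom s t)).trans (smul_add _ _ _)
        map_smul' := fun a s => (congrArg (fun t => (algebraMap ℂ (Hol n U) c) • t)
          (map_smul (g.app (op U)).hom a s)).trans (smul_comm (algebraMap ℂ (Hol n U) c) a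
            (g.app (op U) s)) })
    (fun U V h s => by
      have h1 := res_app g h s
      have h2 := res_smul G h (algebraMap ℂ (Hol n U) c) (g.app (op U) s)
      exact (congrArg (fun t => (algebraMap ℂ (Hol n V) c) • t) h1).trans h2.symm)⟩

theorem smul_hom_apply {F G : PMod (HolSheaf n X)} (c : ℂ) (g : F ⟶ G) (U : Opens (Sp X))
    (s : F.obj (op U)) :
    (c • g).app (op U) s = (algebraMap ℂ (Hol n U) c) • g.app (op U) s := rfl

instance (F G : PMod (HolSheaf n X)) : Module ℂ (F ⟶ G) where
  one_smul g := PMod.hom_ext fun U s => by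
    rw [smul_hom_apply, map_one]; exact one_smul _ _
  mul_smul a b g := PMod.hom_ext fun U s => by
    rw [smul_hom_apply, map_mul]; exact mul_smul _ _ _
  smul_zero a := PMod.hom_ext fun U s => by
    rw [smul_hom_apply]; exact smul_zero _
  smul_add a g h := PMod.hom_ext fun U s => by
    rw [smul_hom_apply]; exact smul_add _ _ _
  add_smul a b g := PMod.hom_ext fun U s => by
    rw [smul_hom_apply, map_add]; exact add_smul _ _ _
  zero_smul g := PMod.hom_ext fun U s => by
    rw [smul_hom_apply, map_zero]; exact zero_smul _ _

instance (F G : OMod n X) : SMul ℂ (F ⟶ G) :=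
  ⟨fun c g => ⟨(c • (show (show PMod (HolSheaf n X) from F.val) ⟶ G.val from g.val) :)⟩⟩

instance (F G : OMod n X) : Module ℂ (F ⟶ G) where
  one_smul g := SheafOfModules.hom_ext (one_smul ℂ (show (show PMod (HolSheaf n X) from F.val) ⟶ G.val from g.val))
  mul_smul a b g := SheafOfModules.hom_ext (mul_smul a b (show (show PMod (HolSheaf n X) from F.val) ⟶ G.val from g.val))
  smul_zero a := SheafOfModules.hom_ext (smul_zero (A := (show PMod (HolSheaf n X) from F.val) ⟶ G.val) a)
  smul_add a g h := SheafOfModules.hom_ext (smul_add (A := (show PMod (HolSheaf n X) from F.val) ⟶ G.val) a g.val h.val)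
  add_smul a b g := SheafOfModules.hom_ext (add_smul a b (show (show PMod (HolSheaf n X) from F.val) ⟶ G.val from g.val))
  zero_smul g := SheafOfModules.hom_ext (zero_smul ℂ (show (show PMod (HolSheaf n X) from F.val) ⟶ G.val from g.val))

instance : Linear ℂ (OMod n X) where
  homModule := inferInstance
  smul_comp _ _ _ c f g := OMod.hom_ext fun U s =>
    map_smul (g.val.app (op U)).hom (algebraMap ℂ (Hol n U) c) (f.val.app (op U) s)
  comp_smul _ _ _ _ _ _ := rfl

instance : HasDerivedCategory.{1} (OMod n X) := HasDerivedCategory.standard _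

/-- A kernel of sheaves of modules is a kernel on sections. -/
theorem exact_sections {A B C : OMod n X} {i : A ⟶ B} {f : B ⟶ C} {w : i ≫ f = 0}
    (h : IsLimit (KernelFork.ofι i w)) (U : Opens (Sp X)) :
    Function.Injective (i.val.app (op U)).hom ∧
      ∀ b : B.val.obj (op U), f.val.app (op U) b = 0 → ∃ a, i.val.app (op U) a = b := by
  let ev := SheafOfModules.evaluation (ringSheaf (HolSheaf n X)) (op U)
  have : ev.PreservesZeroMorphisms := ⟨fun _ _ => rfl⟩
  have : PreservesFiniteLimits ev :=
    SheafOfModules.Finite.evaluationPreservesFiniteLimits _ (op U)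
  have h' := KernelFork.mapIsLimit _ h ev
  have hmono : Mono (ev.map i) := mono_of_isLimit_fork h'
  refine ⟨(ModuleCat.mono_iff_injective _).1 hmono, ?_⟩
  let S : ShortComplex (ModuleCat (Hol n U)) := ⟨ev.map i, ev.map f, by
    rw [← ev.map_comp, w, ev.map_zero]⟩
  have hS : S.Exact := S.exact_of_f_is_kernel h'
  rw [ShortComplex.moduleCat_exact_iff] at hS
  exact hS

/-- A morphism which is a kernel on sections is a kernel of sheaves of modules. -/
theorem isKernel_of_sections {A B C : OMod n X} {i : A ⟶ B} {f : B ⟶ C} (w : i ≫ f = 0)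
    (h : ∀ U : Opens (Sp X), Function.Injective (i.val.app (op U)).hom ∧
      ∀ b : B.val.obj (op U), f.val.app (op U) b = 0 → ∃ a, i.val.app (op U) a = b) :
    Nonempty (IsLimit (KernelFork.ofι i w)) := by
  have key : ∀ {T : OMod n X} (k : T ⟶ B), k ≫ f = 0 → ∃ l : T ⟶ A, l ≫ i = k := by
    intro T k hk
    have hk' : ∀ (U : Opens (Sp X)) (t : T.val.obj (op U)),
        f.val.app (op U) (k.val.app (op U) t) = 0 := fun U t =>
      congrArg (fun g : T ⟶ C => g.val.app (op U) t) hk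
    choose g hg using fun U t => (h U).2 _ (hk' U t)
    refine ⟨⟨mkHom (M := T.val) (N := A.val) (fun U =>
      { toFun := g U
        map_add' := fun a b => (h U).1 ?_
        map_smul' := fun c a => (h U).1 ?_ }) ?_⟩, ?_⟩
    · exact (hg U (a + b)).trans ((map_add (k.val.app (op U)).hom a b).trans
        ((congrArg₂ (· + ·) (hg U a) (hg U b)).symm.trans
          (map_add (i.val.app (op U)).hom _ _).symm))
    · exact (hg U (c • a)).trans ((map_smul (k.val.app (op U)).hom c a).trans
        ((congrArg (fun t => c • t) (hg U a)).symm.trans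
          (map_smul (i.val.app (op U)).hom _ _).symm))
    · intro U V hV s
      refine (h V).1 ?_
      exact (hg V _).trans ((res_app k.val hV s).trans
        ((congrArg (res B.val hV) (hg U s)).symm.trans (res_app i.val hV _).symm))
    · exact OMod.hom_ext hg
  have hm : Mono i := ⟨fun a b hab => OMod.hom_ext fun U s => (h U).1
    (congrArg (fun g => g.val.app (op U) s) hab)⟩
  exact ⟨KernelFork.IsLimit.ofι i w (fun k hk => (key k hk).choose)
    (fun k hk => (key k hk).choose_spec) (fun k hk m hm' => by
      rw [← cancel_mono i, hm', (key k hk).choose_spec])⟩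

/-- The jet functor is left exact. -/
theorem jet_preserves_kernel {A B C : OMod n X} {i : A ⟶ B} {f : B ⟶ C} {w : i ≫ f = 0}
    (h : IsLimit (KernelFork.ofι i w)) :
    Nonempty (IsLimit (KernelFork.ofι ((Jet n X).map i) (f := (Jet n X).map f)
      (by rw [← Functor.map_comp, w, Functor.map_zero]))) := by
  refine isKernel_of_sections _ fun U => ⟨?_, ?_⟩
  · intro p q hpq
    refine Prod.ext ((exact_sections h U).1 (congrArg Prod.fst hpq)) ?_
    refine HomSec.ext_apply fun V hV v => (exact_sections h V).1 ?_
    exact congrArg (fun r : JetSec B.val U => r.2.app V hV v) hpq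
  · intro b hb
    change ∃ a : JetSec A.val U, _
    obtain ⟨s, β⟩ : JetSec B.val U := b
    obtain ⟨a, ha⟩ := (exact_sections h U).2 s (congrArg Prod.fst hb)
    have hβ : ∀ (V : Opens (Sp X)) (hV : V ≤ U) (v : (tangentSheaf n X).obj (op V)),
        f.val.app (op V) (β.app V hV v) = 0 := fun V hV v =>
      congrArg (fun r : JetSec C.val U => r.2.app V hV v) hb
    choose g hg using fun V hV v => (exact_sections h V).2 _ (hβ V hV v)
    refine ⟨(a, ⟨fun V hV =>
      { toFun := g V hV
        map_add' := fun v w => (exact_sections h V).1 ?_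
        map_smul' := fun c v => (exact_sections h V).1 ?_ }, ?_⟩), Prod.ext ha ?_⟩
    · exact (hg V hV (v + w)).trans ((map_add (β.app V hV) v w).trans
        ((congrArg₂ (· + ·) (hg V hV v) (hg V hV w)).symm.trans
          (map_add (i.val.app (op V)).hom _ _).symm))
    · exact (hg V hV (c • v)).trans ((map_smul (β.app V hV) c v).trans
        ((congrArg (fun t => c • t) (hg V hV v)).symm.trans
          (map_smul (i.val.app (op V)).hom _ _).symm))
    · intro V W hV hW v
      refine (exact_sections h W).1 ?_
      exact ((res_app i.val hW _).trans ((congrArg (res B.val hW) (hg V hV v)).trans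
        (β.natural V W hV hW v))).trans (hg W _ _).symm
    · exact HomSec.ext_apply fun V hV v => hg V hV v

theorem jet_f_pOpcycles (S : ShortComplex (OMod n X)) :
    (S.map (Jet n X)).f ≫ (Jet n X).map S.pOpcycles = 0 :=
  ((Jet n X).map_comp S.f S.pOpcycles).symm.trans ((congrArg (Jet n X).map S.f_pOpcycles).trans ((Jet n X).map_zero _ _))

/-- The morphism from the cokernel of `J¹(S.f)` to `J¹` of the cokernel of `S.f`. -/
def jetOpcycles (S : ShortComplex (OMod n X)) :
    (S.map (Jet n X)).opcycles ⟶ (Jet n X).obj S.opcycles :=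
  (S.map (Jet n X)).descOpcycles ((Jet n X).map S.pOpcycles) (jet_f_pOpcycles S)

theorem p_jetOpcycles (S : ShortComplex (OMod n X)) :
    (S.map (Jet n X)).pOpcycles ≫ jetOpcycles S = (Jet n X).map S.pOpcycles :=
  (S.map (Jet n X)).p_descOpcycles _ _

theorem jetOpcycles_from (S : ShortComplex (OMod n X)) :
    jetOpcycles S ≫ (Jet n X).map S.fromOpcycles = (S.map (Jet n X)).fromOpcycles := by
  have h1 : (Jet n X).map S.pOpcycles ≫ (Jet n X).map S.fromOpcycles =
      (S.map (Jet n X)).g := by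
    rw [← Functor.map_comp, S.p_fromOpcycles, ShortComplex.map_g]
  have h2 := (S.map (Jet n X)).p_fromOpcycles
  refine (cancel_epi (S.map (Jet n X)).pOpcycles).1 ?_
  refine (Category.assoc _ _ _).symm.trans ?_
  exact (congrArg (· ≫ (Jet n X).map S.fromOpcycles) (p_jetOpcycles S)).trans (h1.trans h2.symm)

/-- The canonical morphism `H(J¹(S)) ⟶ J¹(H(S))`, for `S` a short complex of `𝒪_X`-modules: it is
induced by `J¹` of the projection of `S.X₂` to the cokernel of `S.f`. It is the inverse of the
identification `J¹(H(S)) ≅ H(J¹(S))` given by the exactness of `J¹`. -/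
def jetHomology (S : ShortComplex (OMod n X)) :
    (S.map (Jet n X)).homology ⟶ (Jet n X).obj S.homology :=
  (jet_preserves_kernel S.homologyIsKernel).some.lift (KernelFork.ofι
    ((S.map (Jet n X)).homologyι ≫ jetOpcycles S)
    ((Category.assoc _ _ _).trans ((congrArg ((S.map (Jet n X)).homologyι ≫ ·)
      (jetOpcycles_from S)).trans (S.map (Jet n X)).homologyι_comp_fromOpcycles)))

theorem jetHomology_ι (S : ShortComplex (OMod n X)) :
    jetHomology S ≫ (Jet n X).map S.homologyι = (S.map (Jet n X)).homologyι ≫ jetOpcycles S :=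
  (jet_preserves_kernel S.homologyIsKernel).some.fac _ WalkingParallelPair.zero

/-- The projection `π : J¹(S) ⟶ S` for a short complex `S`. -/
def jetScπ (S : ShortComplex (OMod n X)) : S.map (Jet n X) ⟶ S where
  τ₁ := (jetπ n X).app S.X₁
  τ₂ := (jetπ n X).app S.X₂
  τ₃ := (jetπ n X).app S.X₃
  comm₁₂ := ((jetπ n X).naturality S.f).symm
  comm₂₃ := ((jetπ n X).naturality S.g).symm

theorem jetHomology_π (S : ShortComplex (OMod n X)) :
    jetHomology S ≫ ((jetπ n X).app S.homology : (Jet n X).obj S.homology ⟶ S.homology) =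
      ShortComplex.homologyMap (jetScπ S) := by
  rw [← cancel_mono S.homologyι, Category.assoc]
  have h1 : (Jet n X).map S.homologyι ≫ ((jetπ n X).app S.opcycles : _ ⟶ S.opcycles) =
    ((jetπ n X).app S.homology : (Jet n X).obj S.homology ⟶ S.homology) ≫ S.homologyι :=
    (jetπ n X).naturality S.homologyι
  have h2 : ShortComplex.homologyMap (jetScπ S) ≫ S.homologyι =
    (S.map (Jet n X)).homologyι ≫ ShortComplex.opcyclesMap (jetScπ S) :=
    ShortComplex.homologyι_naturality (jetScπ S)
  have h3 : (S.map (Jet n X)).pOpcycles ≫ ShortComplex.opcyclesMap (jetScπ S) =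
    ((jetπ n X).app S.X₂ : (Jet n X).obj S.X₂ ⟶ S.X₂) ≫ S.pOpcycles :=
    ShortComplex.p_opcyclesMap (jetScπ S)
  have h4 : (Jet n X).map S.pOpcycles ≫ ((jetπ n X).app S.opcycles : _ ⟶ S.opcycles) =
    ((jetπ n X).app S.X₂ : (Jet n X).obj S.X₂ ⟶ S.X₂) ≫ S.pOpcycles :=
    (jetπ n X).naturality S.pOpcycles
  have h5 : jetOpcycles S ≫ ((jetπ n X).app S.opcycles : _ ⟶ S.opcycles) =
      ShortComplex.opcyclesMap (jetScπ S) := by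
    rw [← cancel_epi (S.map (Jet n X)).pOpcycles, reassoc_of% (p_jetOpcycles S), h3]
    exact h4
  rw [h2, ← h1, reassoc_of% (jetHomology_ι S), h5]

end Homological

section Gauge
open Limits

variable {n : ℕ} {X : Type} [TopologicalSpace X] [ChartedSpace (Fin n → ℂ) X]

theorem jetι_π (F : OMod n X) : (jetι n X).app F ≫ (jetπ n X).app F = 0 := rfl

/-- A holomorphic connection on an `𝒪_X`-module `F`: a splitting of the Atiyah sequence
`0 ⟶ Ω¹(F) ⟶ J¹(F) ⟶ F ⟶ 0`. -/
@[ext]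
structure Connection (F : OMod n X) where
  hom : F ⟶ (Jet n X).obj F
  hom_π : hom ≫ (jetπ n X).app F = 𝟙 F

/-- The connection `∇ + ε E`, for `E ∈ Hom(F, Ω¹(F))`. -/
def Connection.vary {F : OMod n X} (θ : Connection F) (E : F ⟶ (Om1 n X).obj F) (ε : ℂ) :
    Connection F where
  hom := θ.hom + ε • (E ≫ (jetι n X).app F)
  hom_π := by
    have h : (ε • (E ≫ (jetι n X).app F)) ≫ (jetπ n X).app F = 0 := by
      rw [Linear.smul_comp, Category.assoc, jetι_π, comp_zero, smul_zero]
    rw [Preadditive.add_comp, θ.hom_π, h, add_zero]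

/-- A `B`-brane on `X`: a bounded complex of coherent `𝒪_X`-modules. (By Oka's theorem an
`𝒪_X`-module is coherent if and only if it is locally of finite presentation.) -/
structure Brane (n : ℕ) (X : Type) [TopologicalSpace X] [ChartedSpace (Fin n → ℂ) X] where
  cplx : CochainComplex (OMod n X) ℤ
  coherent : ∀ i, (cplx.X i).IsFinitePresentation
  bounded : ∃ a b : ℤ, ∀ i, i < a ∨ b < i → IsZero (cplx.X i)

/-- The complex `J¹(F•)`. -/
def jetCplx (K : CochainComplex (OMod n X) ℤ) : CochainComplex (OMod n X) ℤ :=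
  ((Jet n X).mapHomologicalComplex (ComplexShape.up ℤ)).obj K

instance : (Om1 n X).Additive where
  map_add := rfl

/-- The complex `Ω¹(F•)`. -/
def omCplx (K : CochainComplex (OMod n X) ℤ) : CochainComplex (OMod n X) ℤ :=
  ((Om1 n X).mapHomologicalComplex (ComplexShape.up ℤ)).obj K

/-- The projection `π : J¹(F•) ⟶ F•`. -/
def πCplx (K : CochainComplex (OMod n X) ℤ) : jetCplx K ⟶ K where
  f i := (jetπ n X).app (K.X i)
  comm' i j _ := ((jetπ n X).naturality (K.d i j)).symm

/-- The inclusion `ι : Ω¹(F•) ⟶ J¹(F•)`. -/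
def ιCplx (K : CochainComplex (OMod n X) ℤ) : omCplx K ⟶ jetCplx K where
  f i := (jetι n X).app (K.X i)
  comm' i j _ := ((jetι n X).naturality (K.d i j)).symm

theorem ιCplx_π (K : CochainComplex (OMod n X) ℤ) : ιCplx K ≫ πCplx K = 0 := by
  ext i : 1
  exact jetι_π (K.X i)

/-- A complex of `𝒪_X`-modules as an object of the derived category. -/
abbrev toD (K : CochainComplex (OMod n X) ℤ) : DerivedCategory (OMod n X) :=
  DerivedCategory.Q.obj K

/-- A gauge field on a complex `F•`: a morphism `ψ : F• ⟶ J¹(F•)` in the derived category such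
that `π ∘ ψ = id`. -/
@[ext]
structure GaugeField (K : CochainComplex (OMod n X) ℤ) where
  hom : toD K ⟶ toD (jetCplx K)
  hom_π : hom ≫ DerivedCategory.Q.map (πCplx K) = 𝟙 (toD K)

namespace GaugeField
variable {K : CochainComplex (OMod n X) ℤ}

/-- The gauge field `ψ + ε ξ`, for `ξ : F• ⟶ Ω¹(F•)` in the derived category. -/
def vary (ψ : GaugeField K) (ξ : toD K ⟶ toD (omCplx K)) (ε : ℂ) : GaugeField K where
  hom := ψ.hom + ε • (ξ ≫ DerivedCategory.Q.map (ιCplx K))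
  hom_π := by
    rw [Preadditive.add_comp, ψ.hom_π, Linear.smul_comp, Category.assoc, ← Functor.map_comp,
      ιCplx_π, Functor.map_zero, comp_zero, smul_zero, add_zero]

/-- The connection on the cohomology sheaf `H^i(F•)` induced by a gauge field: the composition
`H^i(F•) ⟶ H^i(J¹(F•)) ⟶ J¹(H^i(F•))` of `H^i(ψ)` with the canonical identification. -/
def induced (ψ : GaugeField K) (i : ℤ) : Connection (K.homology i) where
  hom := ((DerivedCategory.homologyFunctorFactors (OMod n X) i).inv.app K ≫
    (DerivedCategory.homologyFunctor (OMod n X) i).map ψ.hom ≫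
    (DerivedCategory.homologyFunctorFactors (OMod n X) i).hom.app (jetCplx K) :
      K.homology i ⟶ (jetCplx K).homology i) ≫ jetHomology (K.sc i)
  hom_π := by
    have h1 : jetHomology (K.sc i) ≫ ((jetπ n X).app (K.homology i) : _ ⟶ K.homology i) =
      HomologicalComplex.homologyMap (πCplx K) i := jetHomology_π (K.sc i)
    have h2 := DerivedCategory.homologyFunctorFactors_hom_naturality (πCplx K) i
    have h3 := (DerivedCategory.homologyFunctorFactors (OMod n X) i).inv_hom_id_app K
    have h4 := congrArg (DerivedCategory.homologyFunctor (OMod n X) i).map ψ.hom_π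
    rw [CategoryTheory.Functor.map_comp, CategoryTheory.Functor.map_id] at h4
    refine (Category.assoc _ _ _).trans ((congrArg _ h1).trans ?_)
    refine (Category.assoc _ _ _).trans ((congrArg _ (Category.assoc _ _ _)).trans ?_)
    have h5 : (DerivedCategory.homologyFunctor (OMod n X) i).map ψ.hom ≫
        ((DerivedCategory.homologyFunctorFactors (OMod n X) i).hom.app (jetCplx K) ≫
          HomologicalComplex.homologyMap (πCplx K) i) =
        (DerivedCategory.homologyFunctorFactors (OMod n X) i).hom.app K :=
      (congrArg ((DerivedCategory.homologyFunctor (OMod n X) i).map ψ.hom ≫ ·) h2.symm).trans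
        ((Category.assoc _ _ _).symm.trans ((congrArg (· ≫
          (DerivedCategory.homologyFunctorFactors (OMod n X) i).hom.app K) h4).trans
            (Category.id_comp _)))
    exact (congrArg ((DerivedCategory.homologyFunctorFactors (OMod n X) i).inv.app K ≫ ·)
      h5).trans h3

end GaugeField

end Gauge

section Curvature

variable {n : ℕ} {X : Type} [TopologicalSpace X] [ChartedSpace (Fin n → ℂ) X]

/-- The covariant derivative `∇_v s` of a section: as `φ = id ⊕ ∇` for a connection
`φ : P ⟶ J¹(P)`, this is the contraction of the second component of `φ(s)` with `v`. -/
def cov {P : PMod (HolSheaf n X)} (φ : P ⟶ jetPre P) {U : Opens (Sp X)} (v : Vec n U)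
    (s : P.obj (op U)) : P.obj (op U) :=
  (show JetSec P U from φ.app (op U) s).2.app U le_rfl v

/-- The condition `π ∘ φ = id`, on sections. -/
def IsSplitting {P : PMod (HolSheaf n X)} (φ : P ⟶ jetPre P) : Prop :=
  ∀ (U : Opens (Sp X)) (s : P.obj (op U)), (show JetSec P U from φ.app (op U) s).1 = s

theorem Connection.isSplitting {F : OMod n X} (θ : Connection F) :
    IsSplitting (P := F.val) θ.hom.val :=
  fun U s => congrArg (fun g : F ⟶ F => g.val.app (op U) s) θ.hom_π

theorem cov_add {P : PMod (HolSheaf n X)} (φ : P ⟶ jetPre P) {U : Opens (Sp X)} (v : Vec n U)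
    (s t : P.obj (op U)) : cov φ v (s + t) = cov φ v s + cov φ v t :=
  congrArg (fun p : JetSec P U => p.2.app U le_rfl v) (map_add (φ.app (op U)).hom s t)

theorem cov_smul {P : PMod (HolSheaf n X)} {φ : P ⟶ jetPre P} (hφ : IsSplitting φ)
    {U : Opens (Sp X)} (v : Vec n U) (f : Hol n U) (s : P.obj (op U)) :
    cov φ v (f • s) = f • cov φ v s + v.app U le_rfl f • s := by
  have h1 : cov φ v (f • s) = rres (R := HolSheaf n X) le_rfl f • cov φ v s +
      v.app U le_rfl (rres (R := HolSheaf n X) le_rfl f) •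
        res P le_rfl (show JetSec P U from φ.app (op U) s).1 :=
    congrArg (fun p : JetSec P U => p.2.app U le_rfl v) (map_smul (φ.app (op U)).hom f s)
  rw [h1, hφ, res_self, rres_self]

theorem cov_res {P : PMod (HolSheaf n X)} (φ : P ⟶ jetPre P) {U V : Opens (Sp X)} (h : V ≤ U)
    (v : Vec n U) (s : P.obj (op U)) :
    res P h (cov φ v s) = cov φ (v.restrict h) (res P h s) := by
  have h1 := (show JetSec P U from φ.app (op U) s).2.natural U V le_rfl h v
  exact h1.trans (congrArg (fun p : JetSec P V => p.2.app V le_rfl (v.restrict h))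
    (res_app φ h s)).symm

/-- The curvature `K = ∇ ∘ ∇`, evaluated on two vector fields:
`K(v, w) s = ∇_v ∇_w s - ∇_w ∇_v s - ∇_[v, w] s`. It is `𝒪_X`-linear in `s`. -/
def curv {P : PMod (HolSheaf n X)} {φ : P ⟶ jetPre P} (hφ : IsSplitting φ) {U : Opens (Sp X)}
    (v w : Vec n U) : P.obj (op U) →ₗ[(HolSheaf n X).obj.obj (op U)] P.obj (op U) where
  toFun s := cov φ v (cov φ w s) - cov φ w (cov φ v s) - cov φ ⁅v, w⁆ s
  map_add' s t := by simp only [cov_add]; abel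
  map_smul' f s := by
    simp only [cov_smul hφ, cov_add, Vec.bracket_app, Derivation.commutator_apply, sub_smul,
      RingHom.id_apply, smul_sub]
    abel

theorem curv_apply {P : PMod (HolSheaf n X)} {φ : P ⟶ jetPre P} (hφ : IsSplitting φ)
    {U : Opens (Sp X)} (v w : Vec n U) (s : P.obj (op U)) :
    curv hφ v w s = cov φ v (cov φ w s) - cov φ w (cov φ v s) - cov φ ⁅v, w⁆ s := rfl

theorem curv_res {P : PMod (HolSheaf n X)} {φ : P ⟶ jetPre P} (hφ : IsSplitting φ)
    {U V : Opens (Sp X)} (h : V ≤ U) (v w : Vec n U) (s : P.obj (op U)) :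
    res P h (curv hφ v w s) = curv hφ (v.restrict h) (w.restrict h) (res P h s) := by
  rw [curv_apply, curv_apply, map_sub, map_sub, cov_res, cov_res, cov_res, cov_res, cov_res]
  rfl

/-- The stalk `𝒪_x` of the sheaf of holomorphic functions. -/
abbrev OStalk (n : ℕ) {X : Type} [TopologicalSpace X] [ChartedSpace (Fin n → ℂ) X]
    (x : Sp X) : Type :=
  (TopCat.Presheaf.stalk (C := CommRingCat.{0}) (HolSheaf n X).obj x : CommRingCat.{0})

/-- The maximal ideal of `𝒪_x`: germs of functions vanishing at `x`. -/
def maxIdeal (n : ℕ) {X : Type} [TopologicalSpace X] [ChartedSpace (Fin n → ℂ) X]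
    (x : Sp X) : Ideal (OStalk n x) :=
  RingHom.ker (smoothSheafCommRing.eval 𝓘(ℂ, Fin n → ℂ) 𝓘(ℂ) X ℂ x)

/-- The germ of a holomorphic function. -/
def ogerm (x : Sp X) (U : Opens (Sp X)) (hx : x ∈ U) : Hol n U →+* OStalk n x :=
  (TopCat.Presheaf.germ (HolSheaf n X).obj U x hx).hom

/-- The constants in `𝒪_x`. -/
def constGerm (x : Sp X) : ℂ →+* OStalk n x :=
  (ogerm x ⊤ trivial).comp (algebraMap ℂ (Hol n (⊤ : Opens (Sp X))))

/-- The stalk of a presheaf of modules. -/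
abbrev MStalk (P : PMod (HolSheaf n X)) (x : Sp X) : Type :=
  (TopCat.Presheaf.stalk (C := Ab.{0}) P.presheaf x : Ab.{0})

/-- The germ of a section. -/
def mgerm (P : PMod (HolSheaf n X)) (x : Sp X) (U : Opens (Sp X)) (hx : x ∈ U) :
    P.obj (op U) →+ MStalk P x :=
  (TopCat.Presheaf.germ P.presheaf U x hx).hom

theorem mgerm_smul (P : PMod (HolSheaf n X)) (x : Sp X) (U : Opens (Sp X)) (hx : x ∈ U)
    (f : Hol n U) (s : P.obj (op U)) :
    mgerm P x U hx (f • s) = ogerm x U hx f • mgerm P x U hx s :=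
  PresheafOfModules.germ_smul P x U hx f s

theorem mgerm_res (P : PMod (HolSheaf n X)) (x : Sp X) {U V : Opens (Sp X)} (h : V ≤ U)
    (hx : x ∈ V) (s : P.obj (op U)) : mgerm P x V hx (res P h s) = mgerm P x U (h hx) s :=
  TopCat.Presheaf.germ_res_apply P.presheaf (homOfLE h) x hx s

theorem exists_mgerm (P : PMod (HolSheaf n X)) {x : Sp X} (t : MStalk P x) (V : Opens (Sp X))
    (hV : x ∈ V) : ∃ (U : Opens (Sp X)) (_ : U ≤ V) (hx : x ∈ U) (s : P.obj (op U)),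
      mgerm P x U hx s = t := by
  obtain ⟨U, h, hx, s, hs⟩ := TopCat.Presheaf.exists_le_germ_eq P.presheaf t hV
  exact ⟨U, h, hx, s, hs⟩

theorem exists_ogerm {x : Sp X} (t : OStalk n x) (V : Opens (Sp X))
    (hV : x ∈ V) : ∃ (U : Opens (Sp X)) (_ : U ≤ V) (hx : x ∈ U) (s : Hol n U),
      ogerm x U hx s = t := by
  obtain ⟨U, h, hx, s, hs⟩ := TopCat.Presheaf.exists_le_germ_eq (HolSheaf n X).obj t hV
  exact ⟨U, h, hx, s, hs⟩

theorem ogerm_res (x : Sp X) {U V : Opens (Sp X)} (h : V ≤ U)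
    (hx : x ∈ V) (s : Hol n U) :
    ogerm x V hx (rres (R := HolSheaf n X) h s) = ogerm x U (h hx) s :=
  TopCat.Presheaf.germ_res_apply (HolSheaf n X).obj (homOfLE h) x hx s

theorem mgerm_eq (P : PMod (HolSheaf n X)) {x : Sp X} {U V : Opens (Sp X)} {hU : x ∈ U}
    {hV : x ∈ V} {s : P.obj (op U)} {t : P.obj (op V)}
    (h : mgerm P x U hU s = mgerm P x V hV t) :
    ∃ (W : Opens (Sp X)) (_ : x ∈ W) (h1 : W ≤ U) (h2 : W ≤ V), res P h1 s = res P h2 t := by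
  obtain ⟨W, hx, i1, i2, e⟩ := TopCat.Presheaf.germ_eq P.presheaf x hU hV s t h
  exact ⟨W, hx, leOfHom i1, leOfHom i2, e⟩

/-- The fiber `F(x) = F_x / 𝔪_x F_x`. -/
def Fiber (P : PMod (HolSheaf n X)) (x : Sp X) : Type :=
  MStalk P x ⧸ (maxIdeal n x • ⊤ : Submodule (OStalk n x) (MStalk P x))

instance (P : PMod (HolSheaf n X)) (x : Sp X) : AddCommGroup (Fiber P x) :=
  inferInstanceAs (AddCommGroup (MStalk P x ⧸ (maxIdeal n x • ⊤ : Submodule (OStalk n x) _)))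

instance (P : PMod (HolSheaf n X)) (x : Sp X) : Module (OStalk n x) (Fiber P x) :=
  inferInstanceAs (Module (OStalk n x)
    (MStalk P x ⧸ (maxIdeal n x • ⊤ : Submodule (OStalk n x) _)))

/-- The fiber is a complex vector space, through the constants `ℂ ⊆ 𝒪_x`. -/
instance (P : PMod (HolSheaf n X)) (x : Sp X) : Module ℂ (Fiber P x) :=
  Module.compHom (Fiber P x) (constGerm (n := n) x)

/-- The value at `x` of a section of `P`, in the fiber at `x`. -/
def value (P : PMod (HolSheaf n X)) {x : Sp X} {U : Opens (Sp X)} (hx : x ∈ U)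
    (s : P.obj (op U)) : Fiber P x :=
  Submodule.Quotient.mk (mgerm P x U hx s)

theorem exists_curvGerm {P : PMod (HolSheaf n X)} {φ : P ⟶ jetPre P} (hφ : IsSplitting φ)
    {x : Sp X} {V : Opens (Sp X)} (hx : x ∈ V) (v w : Vec n V) :
    ∃ k : MStalk P x →ₗ[OStalk n x] MStalk P x,
      ∀ (U : Opens (Sp X)) (hU : x ∈ U) (hUV : U ≤ V) (s : P.obj (op U)),
        k (mgerm P x U hU s) =
          mgerm P x U hU (curv hφ (v.restrict hUV) (w.restrict hUV) s) := by
  choose D hD hDx σ hσ using fun t : MStalk P x => exists_mgerm P t V hx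
  have key : ∀ (U : Opens (Sp X)) (hU : x ∈ U) (hUV : U ≤ V) (s : P.obj (op U)) (t : MStalk P x),
      mgerm P x U hU s = t →
      mgerm P x (D t) (hDx t) (curv hφ (v.restrict (hD t)) (w.restrict (hD t)) (σ t)) =
        mgerm P x U hU (curv hφ (v.restrict hUV) (w.restrict hUV) s) := by
    intro U hU hUV s t hst
    obtain ⟨W, hW, h1, h2, e⟩ := mgerm_eq P ((hσ t).trans hst.symm)
    rw [← mgerm_res P x h1 hW, ← mgerm_res P x h2 hW, curv_res, curv_res, e]
    rfl
  refine ⟨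
    { toFun := fun t => mgerm P x (D t) (hDx t)
        (curv hφ (v.restrict (hD t)) (w.restrict (hD t)) (σ t))
      map_add' := fun s t => ?_
      map_smul' := fun f t => ?_ }, fun U hU hUV s => key U hU hUV s _ rfl⟩
  · have h1 : D s ⊓ D t ≤ D s := inf_le_left
    have h2 : D s ⊓ D t ≤ D t := inf_le_right
    have hx' : x ∈ D s ⊓ D t := ⟨hDx s, hDx t⟩
    rw [key (D s ⊓ D t) hx' (h1.trans (hD s)) (res P h1 (σ s) + res P h2 (σ t)) (s + t) (by
      rw [map_add, mgerm_res, mgerm_res, hσ, hσ])]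
    rw [← mgerm_res P x h1 hx', ← mgerm_res P x h2 hx', curv_res, curv_res, map_add, map_add]
    rfl
  · obtain ⟨U, hUV, hU, g, hg⟩ := exists_ogerm f (D t) (hDx t)
    rw [key U hU (hUV.trans (hD t)) (g • res P hUV (σ t)) (f • t) (by
      rw [mgerm_smul, mgerm_res, hσ, hg])]
    rw [map_smul, mgerm_smul, hg, RingHom.id_apply, ← mgerm_res P x hUV hU, curv_res]
    rfl

/-- The curvature `K(v, w)` on germs at `x`, for vector fields `v`, `w` defined near `x`. -/
def curvGerm {P : PMod (HolSheaf n X)} {φ : P ⟶ jetPre P} (hφ : IsSplitting φ)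
    {x : Sp X} {V : Opens (Sp X)} (hx : x ∈ V) (v w : Vec n V) :
    MStalk P x →ₗ[OStalk n x] MStalk P x :=
  (exists_curvGerm hφ hx v w).choose

/-- The curvature `K(v, w)` on the fiber `F(x)`, characterized by
`K(v, w) (value of s at x) = value of (K(v, w) s) at x`. -/
def curvFiber {P : PMod (HolSheaf n X)} {φ : P ⟶ jetPre P} (hφ : IsSplitting φ)
    {x : Sp X} {V : Opens (Sp X)} (hx : x ∈ V) (v w : Vec n V) : Fiber P x →ₗ[ℂ] Fiber P x :=
  letI k : Fiber P x →ₗ[OStalk n x] Fiber P x := Submodule.mapQ _ _ (curvGerm hφ hx v w)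
    (by
      rw [← Submodule.map_le_iff_le_comap, Submodule.map_smul'']
      exact Submodule.smul_mono le_rfl le_top)
  { toFun := k
    map_add' := map_add k
    map_smul' := fun c t => map_smul k (constGerm x c) t }

theorem curvFiber_value {P : PMod (HolSheaf n X)} {φ : P ⟶ jetPre P} (hφ : IsSplitting φ)
    {x : Sp X} {V : Opens (Sp X)} (hx : x ∈ V) (v w : Vec n V) (s : P.obj (op V)) :
    curvFiber hφ hx v w (value P hx s) = value P hx (curv hφ v w s) :=
  congrArg Submodule.Quotient.mk
    ((exists_curvGerm hφ hx v w).choose_spec V hx le_rfl s)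

end Curvature

section Coordinates

variable {n : ℕ} {X : Type} [TopologicalSpace X] [ChartedSpace (Fin n → ℂ) X]

/-- An open subset of the space underlying `X`, as an open subset of `X`. -/
def toOpens (U : Opens (Sp X)) : Opens X := U

/-- Evaluation of a holomorphic function on `U` at a point of `U`. -/
def holFun {U : Opens (Sp X)} (f : Hol n U) (x : X) (hx : x ∈ toOpens U) : ℂ :=
  (show C^∞⟮𝓘(ℂ, Fin n → ℂ), (toOpens U); 𝓘(ℂ), ℂ⟯ from f) ⟨x, hx⟩

open Classical in
/-- A holomorphic function on `U`, extended by zero to all of `X`. -/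
def extZero {U : Opens (Sp X)} (f : Hol n U) (x : X) : ℂ :=
  if hx : x ∈ toOpens U then holFun f x hx else 0

theorem extZero_of_mem {U : Opens (Sp X)} (f : Hol n U) {x : X} (hx : x ∈ toOpens U) :
    extZero f x = holFun f x hx := dif_pos hx

theorem contMDiffOn_extZero {U : Opens (Sp X)} (f : Hol n U) :
    ContMDiffOn 𝓘(ℂ, Fin n → ℂ) 𝓘(ℂ) ∞ (extZero f) (toOpens U) := by
  intro x hx
  refine ContMDiffAt.contMDiffWithinAt ?_
  have h1 := (show C^∞⟮𝓘(ℂ, Fin n → ℂ), (toOpens U); 𝓘(ℂ), ℂ⟯ from f).contMDiff ⟨x, hx⟩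
  refine (contMDiffAt_subtype_iff (U := toOpens U) (x := ⟨x, hx⟩)).1
    (h1.congr_of_eventuallyEq (Filter.Eventually.of_forall fun y => ?_))
  exact extZero_of_mem f y.2

/-- The expression of a holomorphic function in the preferred chart at `x₀`. -/
def inChart (x₀ : X) {U : Opens (Sp X)} (f : Hol n U) (z : Fin n → ℂ) : ℂ :=
  extZero f ((chartAt (Fin n → ℂ) x₀).symm z)

/-- The image of `U` in the preferred chart at `x₀`. -/
def chartImage (n : ℕ) {X : Type} [TopologicalSpace X] [ChartedSpace (Fin n → ℂ) X] (x₀ : X)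
    (U : Opens (Sp X)) : Set (Fin n → ℂ) :=
  (chartAt (Fin n → ℂ) x₀).target ∩ (chartAt (Fin n → ℂ) x₀).symm ⁻¹' (toOpens U)

theorem isOpen_chartImage (x₀ : X) (U : Opens (Sp X)) : IsOpen (chartImage n x₀ U) :=
  (chartAt (Fin n → ℂ) x₀).isOpen_inter_preimage_symm (toOpens U).2

theorem contDiffOn_inChart [IsManifold 𝓘(ℂ, Fin n → ℂ) ∞ X] (x₀ : X) {U : Opens (Sp X)}
    (f : Hol n U) : ContDiffOn ℂ ∞ (inChart x₀ f) (chartImage n x₀ U) := by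
  rw [← contMDiffOn_iff_contDiffOn]
  exact (contMDiffOn_extZero f).comp (contMDiffOn_chart_symm.mono Set.inter_subset_left)
    (fun z hz => hz.2)

theorem chart_mem_chartImage {x₀ : X} {U : Opens (Sp X)} {y : X}
    (hy : y ∈ (chartAt (Fin n → ℂ) x₀).source) (hU : y ∈ toOpens U) :
    chartAt (Fin n → ℂ) x₀ y ∈ chartImage n x₀ U := by
  refine ⟨(chartAt (Fin n → ℂ) x₀).map_source hy, ?_⟩
  rw [Set.mem_preimage, (chartAt (Fin n → ℂ) x₀).left_inv hy]
  exact hU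

/-- The domain of the preferred chart at `x₀`. -/
def chartDomain (n : ℕ) {X : Type} [TopologicalSpace X] [ChartedSpace (Fin n → ℂ) X] (x₀ : X) :
    Opens (Sp X) :=
  ⟨(chartAt (Fin n → ℂ) x₀).source, (chartAt (Fin n → ℂ) x₀).open_source⟩

/-- The derivative of a holomorphic function in the coordinate direction `u`. -/
def coordDeriv [IsManifold 𝓘(ℂ, Fin n → ℂ) ∞ X] (x₀ : X) (u : Fin n → ℂ) {U : Opens (Sp X)}
    (hU : U ≤ chartDomain n x₀) (f : Hol n U) : Hol n U :=
  (⟨fun y : toOpens U => fderiv ℂ (inChart x₀ f) (chartAt (Fin n → ℂ) x₀ y) u, by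
    intro y
    refine (contMDiffAt_subtype_iff (U := toOpens U) (x := y)
      (f := fun y : X => fderiv ℂ (inChart x₀ f) (chartAt (Fin n → ℂ) x₀ y) u)).2 ?_
    have h1 : ContDiffOn ℂ ∞ (fun z => fderiv ℂ (inChart x₀ f) z u) (chartImage n x₀ U) :=
      ((contDiffOn_inChart x₀ f).fderiv_of_isOpen (isOpen_chartImage x₀ U)
        (by norm_num)).clm_apply contDiffOn_const
    have h2 := (contMDiffOn_iff_contDiffOn.2 h1).contMDiffAt
      ((isOpen_chartImage x₀ U).mem_nhds (chart_mem_chartImage (hU y.2) y.2))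
    have h3 : ContMDiffAt 𝓘(ℂ, Fin n → ℂ) 𝓘(ℂ, Fin n → ℂ) ∞ (chartAt (Fin n → ℂ) x₀) (y : X) :=
      contMDiffOn_chart.contMDiffAt ((chartAt (Fin n → ℂ) x₀).open_source.mem_nhds (hU y.2))
    exact h2.comp (y : X) h3⟩ : C^∞⟮𝓘(ℂ, Fin n → ℂ), (toOpens U); 𝓘(ℂ), ℂ⟯)

theorem hol_ext {U : Opens (Sp X)} {f g : Hol n U}
    (h : ∀ (x : X) (hx : x ∈ toOpens U), holFun f x hx = holFun g x hx) : f = g :=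
  ContMDiffMap.ext (f := (show C^∞⟮𝓘(ℂ, Fin n → ℂ), (toOpens U); 𝓘(ℂ), ℂ⟯ from f))
    (g := g) fun y => h y.1 y.2

theorem inChart_eqOn (x₀ : X) {U : Opens (Sp X)} (f : Hol n U) {z : Fin n → ℂ}
    (hz : z ∈ chartImage n x₀ U) : inChart x₀ f z = holFun f _ hz.2 :=
  extZero_of_mem f hz.2

theorem holFun_coordDeriv [IsManifold 𝓘(ℂ, Fin n → ℂ) ∞ X] (x₀ : X) (u : Fin n → ℂ)
    {U : Opens (Sp X)} (hU : U ≤ chartDomain n x₀) (f : Hol n U) (x : X)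
    (hx : x ∈ toOpens U) : holFun (coordDeriv x₀ u hU f) x hx =
      fderiv ℂ (inChart x₀ f) (chartAt (Fin n → ℂ) x₀ x) u := rfl

theorem holFun_add {U : Opens (Sp X)} (f g : Hol n U) (x : X) (hx : x ∈ toOpens U) :
    holFun (f + g) x hx = holFun f x hx + holFun g x hx := rfl

theorem holFun_mul {U : Opens (Sp X)} (f g : Hol n U) (x : X) (hx : x ∈ toOpens U) :
    holFun (f * g) x hx = holFun f x hx * holFun g x hx := rfl

theorem holFun_smul {U : Opens (Sp X)} (c : ℂ) (g : Hol n U) (x : X)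
    (hx : x ∈ toOpens U) : holFun (c • g) x hx = c * holFun g x hx := rfl

theorem holFun_rres {U V : Opens (Sp X)} (h : V ≤ U) (f : Hol n U) (x : X)
    (hx : x ∈ toOpens V) :
    holFun (rres (R := HolSheaf n X) h f) x hx = holFun f x (h hx) := rfl

/-- The coordinate vector field `∂_u` on the domain of the preferred chart at `x₀`: the constant
vector field `u` in this chart. -/
def coordField [IsManifold 𝓘(ℂ, Fin n → ℂ) ∞ X] (x₀ : X) (u : Fin n → ℂ) :
    Vec n (chartDomain n x₀) where
  app U hU := Derivation.mk'
    { toFun := coordDeriv x₀ u hU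
      map_add' := fun f g => hol_ext fun x hx => by
        have hm := chart_mem_chartImage (n := n) (X := X) (x₀ := x₀) (U := U) (y := x) (hU hx) hx
        have hn := (isOpen_chartImage x₀ U).mem_nhds hm
        have hf := ((contDiffOn_inChart x₀ f).contDiffAt hn).differentiableAt (by norm_num)
        have hg := ((contDiffOn_inChart x₀ g).contDiffAt hn).differentiableAt (by norm_num)
        rw [holFun_add, holFun_coordDeriv, holFun_coordDeriv, holFun_coordDeriv]
        have : inChart x₀ (f + g) =ᶠ[nhds (chartAt (Fin n → ℂ) x₀ x)]
            (fun z => inChart x₀ f z + inChart x₀ g z) := by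
          filter_upwards [hn] with z hz
          rw [inChart_eqOn x₀ _ hz, inChart_eqOn x₀ _ hz, inChart_eqOn x₀ _ hz, holFun_add]
        rw [this.fderiv_eq, show fderiv ℂ (fun z => inChart x₀ f z + inChart x₀ g z) (chartAt (Fin n → ℂ) x₀ x) = _ from
          fderiv_fun_add hf hg]
        rfl
      map_smul' := fun c f => hol_ext fun x hx => by
        have hm := chart_mem_chartImage (n := n) (X := X) (x₀ := x₀) (U := U) (y := x) (hU hx) hx
        have hn := (isOpen_chartImage x₀ U).mem_nhds hm
        have hf := ((contDiffOn_inChart x₀ f).contDiffAt hn).differentiableAt (by norm_num)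
        rw [RingHom.id_apply, holFun_smul, holFun_coordDeriv, holFun_coordDeriv]
        have : inChart x₀ (c • f) =ᶠ[nhds (chartAt (Fin n → ℂ) x₀ x)]
            (fun z => c * inChart x₀ f z) := by
          filter_upwards [hn] with z hz
          rw [inChart_eqOn x₀ _ hz, inChart_eqOn x₀ _ hz, holFun_smul]
        rw [this.fderiv_eq, show fderiv ℂ (fun z => c * inChart x₀ f z) (chartAt (Fin n → ℂ) x₀ x) = _ from
          fderiv_const_mul hf c]
        rfl }
    (fun f g => hol_ext fun x hx => by
      have hm := chart_mem_chartImage (n := n) (X := X) (x₀ := x₀) (U := U) (y := x) (hU hx) hx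
      have hn := (isOpen_chartImage x₀ U).mem_nhds hm
      have hf := ((contDiffOn_inChart x₀ f).contDiffAt hn).differentiableAt (by norm_num)
      have hg := ((contDiffOn_inChart x₀ g).contDiffAt hn).differentiableAt (by norm_num)
      change holFun (coordDeriv x₀ u hU (f * g)) x hx =
        holFun f x hx * holFun (coordDeriv x₀ u hU g) x hx +
          holFun g x hx * holFun (coordDeriv x₀ u hU f) x hx
      rw [holFun_coordDeriv, holFun_coordDeriv, holFun_coordDeriv]
      have : inChart x₀ (f * g) =ᶠ[nhds (chartAt (Fin n → ℂ) x₀ x)]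
          (fun z => inChart x₀ f z * inChart x₀ g z) := by
        filter_upwards [hn] with z hz
        rw [inChart_eqOn x₀ _ hz, inChart_eqOn x₀ _ hz, inChart_eqOn x₀ _ hz, holFun_mul]
      have e : ∀ h : Hol n U, inChart x₀ h (chartAt (Fin n → ℂ) x₀ x) = holFun h x hx := by
        intro h
        rw [inChart, (chartAt (Fin n → ℂ) x₀).left_inv (hU hx), extZero_of_mem h hx]
      rw [this.fderiv_eq, show fderiv ℂ (fun z => inChart x₀ f z * inChart x₀ g z) (chartAt (Fin n → ℂ) x₀ x) = _ from
        fderiv_fun_mul hf hg, e, e]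
      rfl)
  natural U V hU hV f := hol_ext fun x hx => by
    have hm := chart_mem_chartImage (n := n) (X := X) (x₀ := x₀) (U := V) (y := x) (hU (hV hx)) hx
    have hn := (isOpen_chartImage x₀ V).mem_nhds hm
    change fderiv ℂ (inChart x₀ f) (chartAt (Fin n → ℂ) x₀ x) u =
      fderiv ℂ (inChart x₀ (rres (R := HolSheaf n X) hV f)) (chartAt (Fin n → ℂ) x₀ x) u
    have : inChart x₀ f =ᶠ[nhds (chartAt (Fin n → ℂ) x₀ x)]
        inChart x₀ (rres (R := HolSheaf n X) hV f) := by
      filter_upwards [hn] with z hz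
      rw [inChart_eqOn x₀ _ hz, inChart_eqOn x₀ _ (⟨hz.1, hV hz.2⟩ : z ∈ chartImage n x₀ U),
        holFun_rres]
    rw [this.fderiv_eq]

end Coordinates

section Metrics
open MeasureTheory

variable {n : ℕ} {X : Type} [TopologicalSpace X] [ChartedSpace (Fin n → ℂ) X]

/-- The structure sheaf as an `𝒪_X`-module. -/
def structureSheaf (n : ℕ) (X : Type) [TopologicalSpace X] [ChartedSpace (Fin n → ℂ) X] :
    OMod n X :=
  SheafOfModules.unit (ringSheaf (HolSheaf n X))

/-- The dual sheaf `ℋom(F, 𝒪_X)`. -/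
def dual (F : OMod n X) : OMod n X := homSheaf F.val (structureSheaf n X)

/-- The canonical map `F ⟶ F^**` on sections: evaluation at a section of `F`. -/
def toBidual (F : OMod n X) {U : Opens (Sp X)} (s : F.val.obj (op U)) :
    (dual (dual F)).val.obj (op U) :=
  (show HomSec (homPre F.val (structureSheaf n X).val) (structureSheaf n X).val U from
    { app := fun V hV =>
        { toFun := fun α : HomSec F.val (structureSheaf n X).val V =>
            α.app V le_rfl (res F.val hV s)
          map_add' := fun _ _ => rfl
          map_smul' := fun f α => by
            change rres (R := HolSheaf n X) le_rfl f • α.app V le_rfl (res F.val hV s) =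
              f • α.app V le_rfl (res F.val hV s)
            rw [rres_self] }
      natural := fun V W hV hW α => by
        have h1 := HomSec.natural (B := (structureSheaf n X).val)
          (show HomSec F.val (structureSheaf n X).val V from α) V W le_rfl hW (res F.val hV s)
        exact h1.trans (congrArg
          ((show HomSec F.val (structureSheaf n X).val V from α).app W hW) (res_res F.val hV hW s)) })

/-- A sheaf of `𝒪_X`-modules is reflexive if the canonical map `F ⟶ F^**` is an isomorphism. -/
def IsReflexive (F : OMod n X) : Prop :=
  ∀ U : Opens (Sp X), Function.Bijective
    (toBidual F : F.val.obj (op U) → (dual (dual F)).val.obj (op U))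

/-- A point of `X`, as a point of the space underlying `X`. -/
def pt (x : X) : Sp X := x

/-- The singular set of `F`: the points at which the stalk of `F` is not free. -/
def singularSet (F : OMod n X) : Set X :=
  {x | ¬ Module.Free (OStalk n (pt x)) (MStalk F.val (pt x))}

open Classical in
/-- The function `x ↦ ⟨Z₁(x), Z₂(x)⟩` on `U` (extended by zero), for a family of inner products on
the fibers of `F`. -/
def pairing {F : OMod n X} (h : ∀ x : X, InnerProductSpace.Core ℂ (Fiber F.val (pt x)))
    {U : Opens (Sp X)} (Z₁ Z₂ : F.val.obj (op U)) (x : X) : ℂ :=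
  if hx : x ∈ toOpens U then (h x).inner (value (x := pt x) F.val hx Z₁) (value (x := pt x) F.val hx Z₂) else 0

/-- A Hermitian metric on the sheaf `F`: Hermitian inner products on all the fibers of `F` such
that, for sections `Z₁`, `Z₂` over an open set `U`, the function `⟨Z₁, Z₂⟩` is locally bounded
on `U` and smooth on `U` outside of the singular set of `F`. -/
structure HermitianMetric (F : OMod n X) where
  core : ∀ x : X, InnerProductSpace.Core ℂ (Fiber F.val (pt x))
  bounded : ∀ (U : Opens (Sp X)) (Z₁ Z₂ : F.val.obj (op U)) (x : X), x ∈ toOpens U →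
    ∃ C : ℝ, ∀ᶠ y in nhds x, ‖pairing core Z₁ Z₂ y‖ ≤ C
  smooth : ∀ (U : Opens (Sp X)) (Z₁ Z₂ : F.val.obj (op U)),
    ContMDiffOn 𝓘(ℝ, Fin n → ℂ) 𝓘(ℝ, ℂ) ∞ (pairing core Z₁ Z₂) ((toOpens U : Set X) \ singularSet F)

/-- The coefficients `G(u, w)` of a family of Hermitian inner products on the tangent spaces, in
the preferred chart at `x₀`, for constant vector fields `u` and `w`. -/
def gram (g : ∀ x : X, InnerProductSpace.Core ℂ (TangentSpace 𝓘(ℂ, Fin n → ℂ) x)) (x₀ : X)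
    (u w : Fin n → ℂ) (z : Fin n → ℂ) : ℂ :=
  (g ((chartAt (Fin n → ℂ) x₀).symm z)).inner
    (mfderiv 𝓘(ℂ, Fin n → ℂ) 𝓘(ℂ, Fin n → ℂ) (chartAt (Fin n → ℂ) x₀).symm z u)
    (mfderiv 𝓘(ℂ, Fin n → ℂ) 𝓘(ℂ, Fin n → ℂ) (chartAt (Fin n → ℂ) x₀).symm z w)

/-- A Kähler metric on `X`: a smooth Hermitian metric on the tangent bundle whose fundamental form
`ω = Im g` is closed. -/
structure KahlerMetric (n : ℕ) (X : Type) [TopologicalSpace X] [ChartedSpace (Fin n → ℂ) X] where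
  core : ∀ x : X, InnerProductSpace.Core ℂ (TangentSpace 𝓘(ℂ, Fin n → ℂ) x)
  smooth : ∀ (x₀ : X) (u w : Fin n → ℂ),
    ContDiffOn ℝ ∞ (gram core x₀ u w) (chartAt (Fin n → ℂ) x₀).target
  closed : ∀ (x₀ : X) (u v w : Fin n → ℂ), ∀ z ∈ (chartAt (Fin n → ℂ) x₀).target,
    fderiv ℝ (fun y => (gram core x₀ v w y).im) z u +
      fderiv ℝ (fun y => (gram core x₀ w u y).im) z v +
      fderiv ℝ (fun y => (gram core x₀ u v y).im) z w = 0

theorem exists_cover [Nonempty X] [SecondCountableTopology X] :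
    ∃ c : ℕ → X, ⋃ k, (chartAt (Fin n → ℂ) (c k)).source = Set.univ := by
  obtain ⟨s, hs, hu⟩ := TopologicalSpace.countable_cover_nhds
    (f := fun x : X => (chartAt (Fin n → ℂ) x).source)
    (fun x => (chartAt (Fin n → ℂ) x).open_source.mem_nhds (mem_chart_source _ x))
  have hne : s.Nonempty := by
    by_contra h
    rw [Set.not_nonempty_iff_eq_empty] at h
    obtain ⟨x⟩ := (inferInstance : Nonempty X)
    have : x ∈ (Set.univ : Set X) := trivial
    rw [← hu, h] at this
    simp at this
  obtain ⟨c, rfl⟩ := hs.exists_eq_range hne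
  exact ⟨c, by rw [← hu]; simp⟩

/-- The volume measure of a Kähler metric. In a chart, it is `det(g_{ij})` times the Lebesgue
measure of `ℂⁿ`; these local measures are glued along a countable cover of `X` by charts. -/
def KahlerMetric.vol [Nonempty X] [SecondCountableTopology X] [MeasurableSpace X]
    (g : KahlerMetric n X) : Measure X :=
  letI c := (exists_cover (n := n) (X := X)).choose
  Measure.sum fun k =>
    (((volume.restrict (chartAt (Fin n → ℂ) (c k)).target).withDensity fun z =>
      ENNReal.ofReal (Matrix.of fun i j : Fin n =>
        gram g.core (c k) (Pi.single i 1) (Pi.single j 1) z).det.re).map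
          (chartAt (Fin n → ℂ) (c k)).symm).restrict
            ((chartAt (Fin n → ℂ) (c k)).source \ ⋃ j < k, (chartAt (Fin n → ℂ) (c j)).source)

theorem exists_orthonormal {V : Type} [AddCommGroup V] [Module ℂ V]
    (h : InnerProductSpace.Core ℂ V) : ∃ s : Fin (Module.finrank ℂ V) → V,
      ∀ i j, h.inner (s i) (s j) = if i = j then 1 else 0 := by
  by_cases hf : FiniteDimensional ℂ V
  · let := h.toNormedAddCommGroup
    let := InnerProductSpace.ofCore h.toCore
    refine ⟨stdOrthonormalBasis ℂ V, fun i j => ?_⟩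
    exact (orthonormal_iff_ite.1 (stdOrthonormalBasis ℂ V).orthonormal) i j
  · rw [Module.finrank_of_not_finite hf]
    exact ⟨Fin.elim0, fun i => i.elim0⟩

/-- An orthonormal basis of a (finite-dimensional) complex vector space with an inner product. -/
def frame {V : Type} [AddCommGroup V] [Module ℂ V] (h : InnerProductSpace.Core ℂ V) :
    Fin (Module.finrank ℂ V) → V :=
  (exists_orthonormal h).choose

/-- The squared norm of an element of `Λ²T^* ⊗ End(W)`, viewed as a function `κ : T → T → End(W)`,
for the metric induced by inner products on `T` and `W`: it is the sum of the `‖κ(e_i, e_j)‖²` for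
`i < j`, where `e` is an orthonormal basis of `T` and `‖A‖² = tr(A^* A)` on `End(W)`. -/
def normSq {T W : Type} [AddCommGroup T] [Module ℂ T] [AddCommGroup W] [Module ℂ W]
    (hT : InnerProductSpace.Core ℂ T) (hW : InnerProductSpace.Core ℂ W)
    (κ : T → T → W →ₗ[ℂ] W) : ℝ :=
  ∑ i, ∑ j, if i < j then
    ∑ a, (hW.inner (κ (frame hT i) (frame hT j) (frame hW a))
      (κ (frame hT i) (frame hT j) (frame hW a))).re else 0

/-- The curvature of a connection at a point, as an element of `Λ²T_x^* ⊗ End(F(x))`. -/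
def Connection.curvAt [IsManifold 𝓘(ℂ, Fin n → ℂ) ∞ X] {F : OMod n X} (θ : Connection F) (x : X)
    (u w : TangentSpace 𝓘(ℂ, Fin n → ℂ) x) : Fiber F.val (pt x) →ₗ[ℂ] Fiber F.val (pt x) :=
  curvFiber θ.isSplitting (x := pt x) (V := chartDomain n x) (mem_chart_source (Fin n → ℂ) x)
    (coordField x u) (coordField x w)

/-- The function `|K_∇|²` on `X`. -/
def Connection.density [IsManifold 𝓘(ℂ, Fin n → ℂ) ∞ X] {F : OMod n X} (θ : Connection F)
    (g : KahlerMetric n X) (h : HermitianMetric F) (x : X) : ℝ :=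
  normSq (g.core x) (h.core x) (θ.curvAt x)

/-- The value `‖K_∇‖² = ∫ |K_∇|² dvol` of the Yang–Mills functional on a connection; the integral
is over the complement of the singular set. -/
def Connection.energy [IsManifold 𝓘(ℂ, Fin n → ℂ) ∞ X] [Nonempty X] [SecondCountableTopology X]
    [MeasurableSpace X] {F : OMod n X} (θ : Connection F)
    (g : KahlerMetric n X) (h : HermitianMetric F) : ℝ :=
  ∫ x in (singularSet F)ᶜ, θ.density g h x ∂g.vol

/-- The integral `‖K_∇‖²` converges. -/
def Connection.FiniteEnergy [IsManifold 𝓘(ℂ, Fin n → ℂ) ∞ X] [Nonempty X]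
    [SecondCountableTopology X] [MeasurableSpace X] {F : OMod n X} (θ : Connection F)
    (g : KahlerMetric n X) (h : HermitianMetric F) : Prop :=
  IntegrableOn (θ.density g h) (singularSet F)ᶜ g.vol

/-- A holomorphic Yang–Mills field on a Hermitian sheaf `F`: a stationary point of the Yang–Mills
functional under the variations `∇ + ε E`, where `ε ∈ ℂ` and `E ∈ Hom(F, Ω¹(F))`. -/
def Connection.IsYangMills [IsManifold 𝓘(ℂ, Fin n → ℂ) ∞ X] [Nonempty X]
    [SecondCountableTopology X] [MeasurableSpace X] {F : OMod n X} (θ : Connection F)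
    (g : KahlerMetric n X) (h : HermitianMetric F) : Prop :=
  ∀ E : F ⟶ (Om1 n X).obj F, (∀ ε : ℂ, (θ.vary E ε).FiniteEnergy g h) ∧
    HasFDerivAt (𝕜 := ℝ) (fun ε : ℂ => (θ.vary E ε).energy g h) 0 0

/-- The value `∑ (-1)^i ‖K_{ϑ^i}‖²` of the Yang–Mills functional on a gauge field of a Hermitian
brane, where `ϑ^i` is the induced connection on the `i`-th cohomology sheaf. -/
def GaugeField.energy [IsManifold 𝓘(ℂ, Fin n → ℂ) ∞ X] [Nonempty X]
    [SecondCountableTopology X] [MeasurableSpace X] {K : CochainComplex (OMod n X) ℤ}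
    (ψ : GaugeField K) (g : KahlerMetric n X) (h : ∀ i, HermitianMetric (K.homology i)) : ℝ :=
  ∑ᶠ i : ℤ, (Int.negOnePow i : ℤ) * (ψ.induced i).energy g (h i)

/-- A Yang–Mills field on a Hermitian brane: a critical point of the Yang–Mills functional, under
the variations `ψ + ε ξ`, where `ε ∈ ℂ` and `ξ : F• ⟶ Ω¹(F•)` in the derived category. -/
def GaugeField.IsYangMills [IsManifold 𝓘(ℂ, Fin n → ℂ) ∞ X] [Nonempty X]
    [SecondCountableTopology X] [MeasurableSpace X] {K : CochainComplex (OMod n X) ℤ}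
    (ψ : GaugeField K) (g : KahlerMetric n X) (h : ∀ i, HermitianMetric (K.homology i)) : Prop :=
  ∀ ξ : toD K ⟶ toD (omCplx K),
    (∀ (ε : ℂ) (i : ℤ), ((ψ.vary ξ ε).induced i).FiniteEnergy g (h i)) ∧
    HasFDerivAt (𝕜 := ℝ) (fun ε : ℂ => (ψ.vary ξ ε).energy g h) 0 0

end Metrics

end BraneYM

end

/-!
The curvature enters the Yang–Mills functional of a brane only through the connections `ϑ^i` induced
on the cohomology sheaves `H^i`, so the point is that a variation of the gauge field `ψ` varies each
`ϑ^i` along a complex line of the form `ϑ^i + ε E`.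

The morphism `H^i ⟶ J¹(H^i)` induced by a morphism `F• ⟶ J¹(F•)` in the derived category depends
`ℂ`-linearly on the latter (`homologyFunctor_map_smul`, `GaugeField.inducedHom_add_smul`). Hence
`ψ + ε ι ∘ ξ` induces `ϑ^i + ε a` with `a` independent of `ε`. For `ε = 1` this is again a splitting
of `J¹(H^i) ⟶ H^i`, so the projection kills `a`, and `a = ι ∘ E` with `E : H^i ⟶ Ω¹(H^i)`
(`GaugeField.exists_induced_vary`).

Since the complex is bounded, the functional is a finite alternating sum of the functionals
`‖K_{ϑ^i + ε E}‖²` (`GaugeField.energy_eq_sum`). All of these are finite and have derivative `0` at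
`ε = 0` by hypothesis, hence so does the sum.
-/

namespace BraneYM

open CategoryTheory Opposite TopologicalSpace Limits

section DerivedCategoryLinear

universe w v u

variable {k : Type*} [Ring k] {C : Type u} [Category.{v} C] [Abelian C] [Linear k C]

theorem homologyMap_smul_id (K : CochainComplex C ℤ) (i : ℤ) (c : k) :
    HomologicalComplex.homologyMap (c • 𝟙 K) i = c • 𝟙 (K.homology i) := by
  change ShortComplex.homologyMap (c • 𝟙 (K.sc i)) = c • 𝟙 (K.sc i).homology
  rw [ShortComplex.homologyMap_smul, ShortComplex.homologyMap_id]

theorem comp_add_smul_comp_comp {A B B' D D' : C} (a : A ⟶ B) (f g : B ⟶ B') (b : B' ⟶ D)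
    (b' : D ⟶ D') (c : k) :
    (a ≫ (f + c • g) ≫ b) ≫ b' = (a ≫ f ≫ b) ≫ b' + c • ((a ≫ g ≫ b) ≫ b') := by
  simp

variable [HasDerivedCategory.{w} C]

/-- The cohomology functor on the derived category is linear. By linearity of composition, only the
scalar endomorphisms of a complex have to be considered, and those come from the category of
complexes. -/
theorem homologyFunctor_map_smul {K L : CochainComplex C ℤ}
    (f : DerivedCategory.Q.obj K ⟶ DerivedCategory.Q.obj L) (i : ℤ) (c : k) :
    (DerivedCategory.homologyFunctor C i).map (c • f) =
      c • (DerivedCategory.homologyFunctor C i).map f := by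
  have h1 : c • f = DerivedCategory.Q.map (c • 𝟙 K) ≫ f := by
    rw [CategoryTheory.Functor.map_smul, CategoryTheory.Functor.map_id, Linear.smul_comp,
      Category.id_comp]
  have h2 : (DerivedCategory.homologyFunctor C i).map (DerivedCategory.Q.map (c • 𝟙 K)) =
      c • 𝟙 _ := by
    rw [← cancel_mono ((DerivedCategory.homologyFunctorFactors C i).hom.app K),
      DerivedCategory.homologyFunctorFactors_hom_naturality]
    refine (congrArg _ (homologyMap_smul_id K i c)).trans ?_
    refine (Linear.comp_smul _ _ _ _ _ _).trans ?_
    rw [Linear.smul_comp, Category.id_comp]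
    exact congrArg (c • ·) (Category.comp_id _)
  rw [h1, Functor.map_comp, h2, Linear.smul_comp, Category.id_comp]

end DerivedCategoryLinear

section Variation

variable {n : ℕ} {X : Type} [TopologicalSpace X] [ChartedSpace (Fin n → ℂ) X]

/-- The inclusion `Ω¹(F) ⟶ J¹(F)` is a kernel of the projection `J¹(F) ⟶ F`. -/
theorem exists_lift_jetι {T F : OMod n X} (a : T ⟶ (Jet n X).obj F)
    (ha : a ≫ (jetπ n X).app F = 0) :
    ∃ E : T ⟶ (Om1 n X).obj F, E ≫ (jetι n X).app F = a := by
  obtain ⟨h⟩ := isKernel_of_sections (jetι_π F) fun U =>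
    ⟨fun _ _ hβ => congrArg Prod.snd hβ,
      fun b hb => ⟨(show JetSec F.val U from b).2, Prod.ext (Eq.symm hb) rfl⟩⟩
  exact ⟨h.lift (KernelFork.ofι a ha), h.fac _ WalkingParallelPair.zero⟩

namespace GaugeField
variable {K : CochainComplex (OMod n X) ℤ}

/-- The morphism `H^i(F•) ⟶ J¹(H^i(F•))` induced by a morphism `F• ⟶ J¹(F•)` in the derived
category. -/
noncomputable def inducedHom (f : toD K ⟶ toD (jetCplx K)) (i : ℤ) :
    K.homology i ⟶ (Jet n X).obj (K.homology i) :=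
  ((DerivedCategory.homologyFunctorFactors (OMod n X) i).inv.app K ≫
    (DerivedCategory.homologyFunctor (OMod n X) i).map f ≫
    (DerivedCategory.homologyFunctorFactors (OMod n X) i).hom.app (jetCplx K) :
      K.homology i ⟶ (jetCplx K).homology i) ≫ jetHomology (K.sc i)

theorem inducedHom_add_smul (f g : toD K ⟶ toD (jetCplx K)) (ε : ℂ) (i : ℤ) :
    inducedHom (f + ε • g) i = inducedHom f i + ε • inducedHom g i := by
  have h : (DerivedCategory.homologyFunctor (OMod n X) i).map (f + ε • g) =
      (DerivedCategory.homologyFunctor (OMod n X) i).map f +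
        ε • (DerivedCategory.homologyFunctor (OMod n X) i).map g := by
    rw [Functor.map_add, homologyFunctor_map_smul]
  unfold inducedHom
  rw [h]
  exact comp_add_smul_comp_comp _ _ _ _ _ ε

/-- A variation of a gauge field acts on the induced connection on `H^i` as the variation by some
`E : H^i ⟶ Ω¹(H^i)`. Both `ψ + ξ` and `ψ` induce splittings of `J¹(H^i) ⟶ H^i`, so their difference
takes values in `Ω¹(H^i)`. -/
theorem exists_induced_vary (ψ : GaugeField K) (ξ : toD K ⟶ toD (omCplx K)) (i : ℤ) :
    ∃ E : K.homology i ⟶ (Om1 n X).obj (K.homology i),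
      ∀ ε : ℂ, (ψ.vary ξ ε).induced i = (ψ.induced i).vary E ε := by
  have hadd : ∀ ε : ℂ, ((ψ.vary ξ ε).induced i).hom = (ψ.induced i).hom +
      ε • inducedHom (ξ ≫ DerivedCategory.Q.map (ιCplx K)) i :=
    fun ε => inducedHom_add_smul _ _ ε i
  obtain ⟨E, hE⟩ := exists_lift_jetι
    (inducedHom (ξ ≫ DerivedCategory.Q.map (ιCplx K)) i) (by
      have h1 := ((ψ.vary ξ 1).induced i).hom_π
      rw [hadd, one_smul, Preadditive.add_comp, (ψ.induced i).hom_π] at h1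
      exact left_eq_add.1 h1.symm)
  exact ⟨E, fun ε => Connection.ext ((hadd ε).trans (by rw [← hE]; rfl))⟩

end GaugeField

end Variation

section ZeroSheaf
open MeasureTheory

variable {n : ℕ} {X : Type} [TopologicalSpace X] [ChartedSpace (Fin n → ℂ) X]

theorem subsingleton_fiber_of_isZero {F : OMod n X} (hF : IsZero F) (x : Sp X) :
    Subsingleton (Fiber F.val x) := by
  have hs : ∀ (U : Opens (Sp X)) (s : F.val.obj (op U)), s = 0 := fun U s =>
    congrArg (fun f : F ⟶ F => f.val.app (op U) s) (hF.eq_of_src (𝟙 F) 0)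
  have hm : ∀ t : MStalk F.val x, t = 0 := fun t => by
    obtain ⟨U, -, hx, s, rfl⟩ := exists_mgerm F.val t ⊤ trivial
    rw [hs U s, map_zero]
  refine subsingleton_of_forall_eq 0 fun a => ?_
  obtain ⟨t, rfl⟩ := Submodule.Quotient.mk_surjective _ a
  rw [hm t]
  rfl

theorem Connection.energy_of_isZero [IsManifold 𝓘(ℂ, Fin n → ℂ) ∞ X] [Nonempty X]
    [SecondCountableTopology X] [MeasurableSpace X] {F : OMod n X} (hF : IsZero F)
    (θ : Connection F) (g : KahlerMetric n X) (h : HermitianMetric F) : θ.energy g h = 0 := by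
  have h0 : θ.density g h = fun _ => 0 := by
    funext x
    have := subsingleton_fiber_of_isZero hF (pt x)
    have : IsEmpty (Fin (Module.finrank ℂ (Fiber F.val (pt x)))) := by
      rw [Module.finrank_zero_of_subsingleton]
      infer_instance
    simp [Connection.density, normSq]
  simp [Connection.energy, h0]

/-- A brane has only finitely many nonzero cohomology sheaves. -/
theorem Brane.exists_finset_isZero_homology (F : Brane n X) :
    ∃ s : Finset ℤ, ∀ i ∉ s, IsZero (F.cplx.homology i) := by
  obtain ⟨a, b, hab⟩ := F.bounded
  refine ⟨Finset.Icc a b, fun i hi => ?_⟩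
  rw [Finset.mem_Icc, not_and_or, not_le, not_le] at hi
  exact ShortComplex.isZero_homology_of_isZero_X₂ (F.cplx.sc i) (hab i hi)

theorem GaugeField.energy_eq_sum [IsManifold 𝓘(ℂ, Fin n → ℂ) ∞ X] [Nonempty X]
    [SecondCountableTopology X] [MeasurableSpace X] {K : CochainComplex (OMod n X) ℤ}
    {s : Finset ℤ} (hs : ∀ i ∉ s, IsZero (K.homology i)) (ψ : GaugeField K)
    (g : KahlerMetric n X) (h : ∀ i, HermitianMetric (K.homology i)) :
    ψ.energy g h = ∑ i ∈ s, (Int.negOnePow i : ℤ) * (ψ.induced i).energy g (h i) := by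
  refine finsum_eq_sum_of_support_subset _ fun i hi => ?_
  by_contra his
  exact hi (by simp [Connection.energy_of_isZero (hs i his)])

end ZeroSheaf

end BraneYM

theorem proposition3p4 {n : ℕ} {X : Type} [TopologicalSpace X] [ChartedSpace (Fin n → ℂ) X]
    [IsManifold 𝓘(ℂ, Fin n → ℂ) ∞ X] [CompactSpace X] [ConnectedSpace X] [T2Space X]
    [SecondCountableTopology X] [MeasurableSpace X] [BorelSpace X]
    (g : BraneYM.KahlerMetric n X) (F : BraneYM.Brane n X)
    (h : ∀ i : ℤ, BraneYM.HermitianMetric (F.cplx.homology i))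
    (hrefl : ∀ i : ℤ, BraneYM.IsReflexive (F.cplx.homology i))
    (ψ : BraneYM.GaugeField F.cplx)
    (hψ : ∀ i : ℤ, (ψ.induced i).IsYangMills g (h i)) :
    ψ.IsYangMills g h := by
  obtain ⟨s, hs⟩ := F.exists_finset_isZero_homology
  intro ξ
  choose E hE using fun i => ψ.exists_induced_vary ξ i
  refine ⟨fun ε i => ?_, ?_⟩
  · rw [hE]
    exact (hψ i (E i)).1 ε
  · simp_rw [BraneYM.GaugeField.energy_eq_sum hs, hE]
    have hsum := HasFDerivAt.fun_sum (u := s) fun i _ =>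
      (hψ i (E i)).2.const_mul ((Int.negOnePow i : ℤ) : ℝ)
    simpa using hsum
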